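/- **Setting.** There are $N$ LoRA layers. Layer $n$ has inputs $X_n\in\mathbb R^{d\times m}$, an optimal pair $A^\star(n)\in\mathbb R^{r\times d}$, $B^\star(n)\in\mathbb R^{d\times r}$, an initialization $A^0(n),B^0(n)$, and the reconstruction loss $\ell_n(A,B)=\tfrac12\|B^\star(n)A^\star(n)X_n-BAX_n\|_F^2$. The initialization and the inputs are fixed (the result is conditional on the random draw of $A^0$). The risk is $\mathcal R_{\rm rec}(\mathbf W)=\frac1N\sum_n\|B^\star(n)A^\star(n)X_n-B(n)A(n)X_n\|_F^2$, and $\delta^0(n)=\|B^\star(n)A^\star(n)(I-P_{A^0(n)})\|_F$ with $P_A=A^\dagger A$, where $A^\dagger$ is the Moore–Penrose pseudoinverse. Training is SGD with step size $\eta$ on the losses $\ell_n$: in round $t$ layer $n$ updates one block, $A$ or $B$, with a stochastic gradient that is conditionally unbiased given the past and whose error has expected squared Frobenius norm at most $\sigma_g^2$ (bounded variance). FFA-LoRA updates $B$ in all layers in all rounds, so $A$ stays at $A^0$. A layer-tied schedule updates in each round the same block in all layers (RoLoRA alternates). **Regime.** For constants $\kappa,\mu,\beta,s_-,s_+>0$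 and all layers $n$: the two block Hessians of $\ell_n$ at $(A^\star(n),B^\star(n))$, and the $B$-block Hessian of $\ell_n(A^0(n),\cdot)$, lie between $\mu I$ and $\beta I$ (block smoothness and block strong convexity); $\sigma_{\max}(X_n)\le\kappa\,\sigma^+_{\min}(X_n^\top A^0(n)^\dagger)$ (well-conditioned inputs; $\sigma_{\min}^+$ is the smallest nonzero singular value); and $s_-\le\sigma_{\max}(X_n)\le s_+$. **Theorem.** (i) *FFA-LoRA.* For all $\kappa,\mu,\beta,s_-,s_+>0$ there are $c,C>0$, depending only on them, such that for every $N,d,r,m$, every configuration in the regime, every $\sigma_g\ge0$ and every $\eta>0$ with $\eta\beta\le1$, every FFA-LoRA run satisfies $$c\cdot\frac1N\sum_n\delta^0(n)^2\;\le\;\liminf_{T\to\infty}\mathbb E[\mathcal R_{\rm rec}(\mathbf W_T)]\;\le\;\limsup_{T\to\infty}\mathbb E[\mathcal R_{\rm rec}(\mathbf W_T)]\;\le\;C\Bigl(\frac1N\sum_n\delta^0(n)^2+\eta\sigma_g^2\Bigr).$$ If moreover for each layer the covariance $\mathbb E[\xi_t^\top\xi_t]$ of the gradient noise $\xi_t$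 converges as $t\to\infty$ (for instance stationary noise, or none), then $\lim_{T\to\infty}\mathbb E[\mathcal R_{\rm rec}(\mathbf W_T)]$ exists and lies between the same bounds. In particular it is $\Theta(\frac1N\sum_n\delta^0(n)^2)$ up to the SGD noise floor $O(\eta\sigma_g^2)$. (ii) *Layer-tied schedules.* There is an absolute $c>0$ such that for every $\eta>0$ there are constants $\kappa,\mu,\beta,s_-,s_+>0$ with $\eta\beta\le1$, for which the following holds for all $N\ge1$, $r\ge1$, $d\ge2r$. There is an $m$ and a configuration of $N$ layers in the regime with $\delta^0(n)>0$ for all $n$ such that for every horizon $T$ there is $\sigma_0>0$ for which every layer-tied schedule and every run of it with step size $\eta$ and gradient noise level $\sigma_g\le\sigma_0$ satisfies $\mathbb E[\mathcal R_{\rm rec}(\mathbf W_T)]\ge c\cdot\frac1N\sum_n\delta^0(n)^2$. (In particular, with exact gradients, $\sigma_g=0$, the floor holds for all $T$.) If $N\ge2$, then on this same configuration some layer-wise schedule with exact gradients has $\mathcal R_{\rm rec}(\mathbf W_T)\to0$. -/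

import Mathlib

open Matrix MeasureTheory Filter Topology
open scoped ENNReal

namespace LoRAFloor

/-! ### Matrix notions -/

/-- The squared Frobenius norm. -/
noncomputable def frobSq {p q : ℕ} (M : Matrix (Fin p) (Fin q) ℝ) : ℝ :=
  ∑ i, ∑ j, M i j ^ 2

/-- The Frobenius norm. -/
noncomputable def frobNorm {p q : ℕ} (M : Matrix (Fin p) (Fin q) ℝ) : ℝ :=
  Real.sqrt (frobSq M)

/-- The four Penrose conditions: `D` is a Moore-Penrose pseudoinverse of `M`. -/
structure IsMoorePenrose {p q : ℕ} (M : Matrix (Fin p) (Fin q) ℝ)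
    (D : Matrix (Fin q) (Fin p) ℝ) : Prop where
  mul_mul_self : M * D * M = M
  self_mul_mul : D * M * D = D
  symm_left : (M * D)ᵀ = M * D
  symm_right : (D * M)ᵀ = D * M

theorem exists_isMoorePenrose {p q : ℕ} (M : Matrix (Fin p) (Fin q) ℝ) :
    ∃ D, IsMoorePenrose M D := by
  have hG : (Mᵀ * M).IsHermitian := by
    rw [Matrix.IsHermitian, Matrix.conjTranspose_eq_transpose_of_trivial]
    simp [Matrix.transpose_mul]
  obtain ⟨G', h1, h2, h3, h4⟩ : ∃ G' : Matrix (Fin q) (Fin q) ℝ,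
      (Mᵀ * M) * G' * (Mᵀ * M) = Mᵀ * M ∧ G' * (Mᵀ * M) * G' = G' ∧ G'ᵀ = G' ∧
      (G' * (Mᵀ * M))ᵀ = G' * (Mᵀ * M) := by
    generalize Mᵀ * M = G at hG
    have hs := hG.spectral_theorem
    rw [Unitary.conjStarAlgAut_apply] at hs
    set U : Matrix (Fin q) (Fin q) ℝ := (hG.eigenvectorUnitary : Matrix (Fin q) (Fin q) ℝ)
    have hU : star U * U = 1 := Unitary.coe_star_mul_self hG.eigenvectorUnitary
    have hst : star U = Uᵀ := by ext i j; simp [Matrix.star_apply]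
    rw [hst] at hU
    set v := hG.eigenvalues
    have hs' : G = U * diagonal v * Uᵀ := by
      rw [hs, ← hst]; rfl
    have key : ∀ a b : Fin q → ℝ, (U * diagonal a * Uᵀ) * (U * diagonal b * Uᵀ)
        = U * diagonal (fun i => a i * b i) * Uᵀ := by
      intro a b
      calc _ = U * diagonal a * (Uᵀ * U) * diagonal b * Uᵀ := by simp only [Matrix.mul_assoc]
        _ = _ := by rw [hU, Matrix.mul_one, Matrix.mul_assoc U, diagonal_mul_diagonal]
    have tr : ∀ a : Fin q → ℝ, (U * diagonal a * Uᵀ)ᵀ = U * diagonal a * Uᵀ := by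
      intro a; simp [Matrix.transpose_mul, Matrix.mul_assoc]
    refine ⟨U * diagonal (fun i => (v i)⁻¹) * Uᵀ, ?_, ?_, tr _, ?_⟩
    · rw [hs', key, key]; congr 3; ext i; exact mul_inv_mul_cancel (v i)
    · rw [hs', key, key]; congr 3; ext i
      by_cases h : v i = 0
      · simp [h]
      · simp [inv_mul_cancel₀ h]
    · rw [hs', key, tr]
  have h5 : M * (G' * (Mᵀ * M)) = M := by
    have h0 : (M - M * (G' * (Mᵀ * M)))ᴴ * (M - M * (G' * (Mᵀ * M))) = 0 := by
      rw [Matrix.conjTranspose_eq_transpose_of_trivial, Matrix.transpose_sub,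
        Matrix.transpose_mul M, h4, Matrix.sub_mul, Matrix.mul_sub, Matrix.mul_sub]
      have e1 : Mᵀ * (M * (G' * (Mᵀ * M))) = Mᵀ * M := by
        rw [← Matrix.mul_assoc, ← Matrix.mul_assoc]; exact h1
      have e2 : G' * (Mᵀ * M) * Mᵀ * (M * (G' * (Mᵀ * M))) = G' * (Mᵀ * M) * Mᵀ * M := by
        rw [Matrix.mul_assoc _ Mᵀ, e1]; simp only [Matrix.mul_assoc]
      rw [e1, e2]; simp
    exact (sub_eq_zero.mp (Matrix.conjTranspose_mul_self_eq_zero.mp h0)).symm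
  refine ⟨G' * Mᵀ, ?_, ?_, ?_, ?_⟩
  · simpa only [Matrix.mul_assoc] using h5
  · calc G' * Mᵀ * M * (G' * Mᵀ) = (G' * (Mᵀ * M) * G') * Mᵀ := by simp only [Matrix.mul_assoc]
      _ = _ := by rw [h2]
  · simp [Matrix.transpose_mul, h3, Matrix.mul_assoc]
  · rw [Matrix.mul_assoc]; exact h4

theorem IsMoorePenrose.unique {p q : ℕ} {M : Matrix (Fin p) (Fin q) ℝ}
    {D E : Matrix (Fin q) (Fin p) ℝ} (hD : IsMoorePenrose M D) (hE : IsMoorePenrose M E) :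
    D = E := by
  have h1 : M * D = M * E := by
    calc M * D = (M * D)ᵀ := hD.symm_left.symm
      _ = ((M * E) * (M * D))ᵀ := by
          rw [← Matrix.mul_assoc (M * E), hE.mul_mul_self]
      _ = (M * D) * (M * E) := by
          rw [Matrix.transpose_mul, hD.symm_left, hE.symm_left]
      _ = M * E := by rw [← Matrix.mul_assoc, hD.mul_mul_self]
  have h2 : D * M = E * M := by
    calc D * M = (D * M)ᵀ := hD.symm_right.symm
      _ = ((D * M) * (E * M))ᵀ := by
          rw [Matrix.mul_assoc D, ← Matrix.mul_assoc M, hE.mul_mul_self]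
      _ = (E * M) * (D * M) := by
          rw [Matrix.transpose_mul, hD.symm_right, hE.symm_right]
      _ = E * M := by rw [Matrix.mul_assoc E, ← Matrix.mul_assoc M, hD.mul_mul_self]
  calc D = D * M * D := hD.self_mul_mul.symm
    _ = E * M * E := by rw [h2, Matrix.mul_assoc, h1, ← Matrix.mul_assoc]
    _ = E := hE.self_mul_mul

/-- The Moore-Penrose pseudoinverse `M†`. -/
noncomputable def pinv {p q : ℕ} (M : Matrix (Fin p) (Fin q) ℝ) : Matrix (Fin q) (Fin p) ℝ :=
  Classical.choose (exists_isMoorePenrose M)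

theorem pinv_spec {p q : ℕ} (M : Matrix (Fin p) (Fin q) ℝ) : IsMoorePenrose M (pinv M) :=
  Classical.choose_spec (exists_isMoorePenrose M)

/-- `P_M = M† M`, the orthogonal projector onto the row space of `M`. -/
noncomputable def rowProj {p q : ℕ} (M : Matrix (Fin p) (Fin q) ℝ) : Matrix (Fin q) (Fin q) ℝ :=
  pinv M * M

/-- The largest singular value. -/
noncomputable def sigmaMax {p q : ℕ} (M : Matrix (Fin p) (Fin q) ℝ) : ℝ :=
  (Matrix.toEuclideanLin M).singularValues 0

/-- The smallest nonzero singular value (and `0` for the zero matrix). Singular values are listed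
in decreasing order from index `0`, and exactly the first `rank M` of them are nonzero. -/
noncomputable def sigmaMinPos {p q : ℕ} (M : Matrix (Fin p) (Fin q) ℝ) : ℝ :=
  (Matrix.toEuclideanLin M).singularValues (M.rank - 1)

/-- The gradient of a function of a matrix: the matrix of its partial derivatives. -/
noncomputable def matGrad {p q : ℕ} (f : Matrix (Fin p) (Fin q) ℝ → ℝ)
    (M : Matrix (Fin p) (Fin q) ℝ) : Matrix (Fin p) (Fin q) ℝ :=
  Matrix.of fun i j => deriv (fun s : ℝ => f (M + s • Matrix.single i j (1 : ℝ))) 0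

/-- The Hessian quadratic form `⟨V, ∇²f(M) V⟩`. -/
noncomputable def hessForm {p q : ℕ} (f : Matrix (Fin p) (Fin q) ℝ → ℝ)
    (M V : Matrix (Fin p) (Fin q) ℝ) : ℝ :=
  iteratedDeriv 2 (fun s : ℝ => f (M + s • V)) 0

/-- `μ I ⪯ ∇²f(M) ⪯ β I`. -/
def HessianBetween {p q : ℕ} (μ β : ℝ) (f : Matrix (Fin p) (Fin q) ℝ → ℝ)
    (M : Matrix (Fin p) (Fin q) ℝ) : Prop :=
  ∀ V, μ * frobSq V ≤ hessForm f M V ∧ hessForm f M V ≤ β * frobSq V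

/-! ### Layers, reconstruction risk, misalignment -/

/-- The two LoRA blocks of a layer. -/
inductive Block where
  | A
  | B

/-- A configuration of `N` LoRA layers of width `d` and rank `r`: for every layer the optimal pair
`(A⋆, B⋆)`, the stacked inputs `X` and the initialization `(A⁰, B⁰)`. -/
structure Config (N d r m : ℕ) where
  Astar : Fin N → Matrix (Fin r) (Fin d) ℝ
  Bstar : Fin N → Matrix (Fin d) (Fin r) ℝ
  X : Fin N → Matrix (Fin d) (Fin m) ℝ
  A0 : Fin N → Matrix (Fin r) (Fin d) ℝ
  B0 : Fin N → Matrix (Fin d) (Fin r) ℝ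

namespace Config

variable {N d r m : ℕ} (P : Config N d r m)

/-- The reconstruction loss of layer `n`, `½ ‖B⋆A⋆X - BAX‖_F²`. -/
noncomputable def layerLoss (n : Fin N) (A : Matrix (Fin r) (Fin d) ℝ)
    (B : Matrix (Fin d) (Fin r) ℝ) : ℝ :=
  (1 / 2) * frobSq (P.Bstar n * P.Astar n * P.X n - B * A * P.X n)

/-- The per-layer reconstruction risk `(1/N) ∑ₙ ‖B⋆A⋆X - BAX‖_F²`. -/
noncomputable def risk (A : Fin N → Matrix (Fin r) (Fin d) ℝ)
    (B : Fin N → Matrix (Fin d) (Fin r) ℝ) : ℝ :=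
  (1 / (N : ℝ)) * ∑ n, frobSq (P.Bstar n * P.Astar n * P.X n - B n * A n * P.X n)

/-- The initial subspace misalignment `δ⁰(n) = ‖B⋆A⋆(I - P_{A⁰})‖_F`. -/
noncomputable def misalign (n : Fin N) : ℝ :=
  frobNorm (P.Bstar n * P.Astar n * (1 - rowProj (P.A0 n)))

/-- `(1/N) ∑ₙ δ⁰(n)²`. -/
noncomputable def meanSqMisalign : ℝ :=
  (1 / (N : ℝ)) * ∑ n, P.misalign n ^ 2

/-- The deterministic standing assumptions, uniformly over the layers: block smoothness and block
strong convexity of the reconstruction quadratics at the optimal pair and, for the block `B`, at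
the frozen initial down-projection; the well-conditioned input regime; inputs of order one. -/
structure Regime (κ μ β sLo sHi : ℝ) : Prop where
  hessA_opt : ∀ n, HessianBetween μ β (fun A => P.layerLoss n A (P.Bstar n)) (P.Astar n)
  hessB_opt : ∀ n, HessianBetween μ β (fun B => P.layerLoss n (P.Astar n) B) (P.Bstar n)
  hessB_init : ∀ n B', HessianBetween μ β (fun B => P.layerLoss n (P.A0 n) B) B'
  conditioned : ∀ n, sigmaMax (P.X n) ≤ κ * sigmaMinPos ((P.X n)ᵀ * pinv (P.A0 n))
  scale : ∀ n, sLo ≤ sigmaMax (P.X n) ∧ sigmaMax (P.X n) ≤ sHi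

end Config

/-! ### Stochastic gradient runs -/

/-- `g` is a stochastic gradient with conditional mean `G` given the past `past` and with variance
at most `σ²`. -/
structure IsStochGrad {Ω : Type*} [MeasurableSpace Ω] (prob : Measure Ω)
    (past : MeasurableSpace Ω) (σ : ℝ) {p q : ℕ}
    (g G : Ω → Matrix (Fin p) (Fin q) ℝ) : Prop where
  integrable : ∀ i j, Integrable (fun ω => g ω i j) prob
  unbiased : ∀ i j, prob[fun ω => g ω i j | past] =ᵐ[prob] fun ω => G ω i j
  integrable_sq : Integrable (fun ω => frobSq (g ω - G ω)) prob
  variance_le : ∫ ω, frobSq (g ω - G ω) ∂prob ≤ σ ^ 2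

/-- `A`, `B` are the iterates of SGD with step size `η` and stochastic gradients `gA`, `gB` of
variance at most `σ²` on the reconstruction losses, where in round `t` layer `n` updates only the
block `mode t n`. -/
structure IsRun {Ω : Type*} [mΩ : MeasurableSpace Ω] (prob : Measure Ω) {N d r m : ℕ}
    (P : Config N d r m) (η σ : ℝ) (mode : ℕ → Fin N → Block) (ℱ : Filtration ℕ mΩ)
    (A : ℕ → Ω → Fin N → Matrix (Fin r) (Fin d) ℝ)
    (B : ℕ → Ω → Fin N → Matrix (Fin d) (Fin r) ℝ)
    (gA : ℕ → Ω → Fin N → Matrix (Fin r) (Fin d) ℝ)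
    (gB : ℕ → Ω → Fin N → Matrix (Fin d) (Fin r) ℝ) : Prop where
  init : ∀ ω n, A 0 ω n = P.A0 n ∧ B 0 ω n = P.B0 n
  adapted_A : ∀ t n i j, Measurable[ℱ t] (fun ω => A t ω n i j)
  adapted_B : ∀ t n i j, Measurable[ℱ t] (fun ω => B t ω n i j)
  step_A : ∀ t n, mode t n = Block.A → ∀ ω,
    A (t + 1) ω n = A t ω n - η • gA t ω n ∧ B (t + 1) ω n = B t ω n
  step_B : ∀ t n, mode t n = Block.B → ∀ ω,
    A (t + 1) ω n = A t ω n ∧ B (t + 1) ω n = B t ω n - η • gB t ω n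
  grad_A : ∀ t n, mode t n = Block.A → IsStochGrad prob (ℱ t) σ (fun ω => gA t ω n)
    (fun ω => matGrad (fun A' => P.layerLoss n A' (B t ω n)) (A t ω n))
  grad_B : ∀ t n, mode t n = Block.B → IsStochGrad prob (ℱ t) σ (fun ω => gB t ω n)
    (fun ω => matGrad (fun B' => P.layerLoss n (A t ω n) B') (B t ω n))

/-- The expected reconstruction risk after `T` rounds. -/
noncomputable def expectedRisk {Ω : Type*} [MeasurableSpace Ω] (prob : Measure Ω) {N d r m : ℕ}
    (P : Config N d r m) (A : ℕ → Ω → Fin N → Matrix (Fin r) (Fin d) ℝ)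
    (B : ℕ → Ω → Fin N → Matrix (Fin d) (Fin r) ℝ) (T : ℕ) : ℝ≥0∞ :=
  ∫⁻ ω, ENNReal.ofReal (P.risk (A T ω) (B T ω)) ∂prob

/-- The noise covariances `𝔼[ξᵀξ]` of the stochastic gradients for the block `B` of each layer
converge as `t → ∞`; for instance, stationary noise or no noise. -/
def NoiseCovConverges {Ω : Type*} [MeasurableSpace Ω] (prob : Measure Ω) {N d r m : ℕ}
    (P : Config N d r m) (A : ℕ → Ω → Fin N → Matrix (Fin r) (Fin d) ℝ)
    (B gB : ℕ → Ω → Fin N → Matrix (Fin d) (Fin r) ℝ) : Prop :=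
  ∀ n, ∀ j k : Fin r, ∃ q : ℝ, Tendsto (fun t => ∫ ω,
    ((gB t ω n - matGrad (fun B' => P.layerLoss n (A t ω n) B') (B t ω n))ᵀ *
      (gB t ω n - matGrad (fun B' => P.layerLoss n (A t ω n) B') (B t ω n))) j k ∂prob)
    atTop (𝓝 q)

/-- FFA-LoRA: every layer updates `B` in every round, so that `A` stays at `A⁰`. -/
def ffaMode (N : ℕ) : ℕ → Fin N → Block := fun _ _ => Block.B

/-- A layer-tied schedule: in each round one block, the same for all layers, is updated. -/
def tiedMode (N : ℕ) (M : ℕ → Block) : ℕ → Fin N → Block := fun t _ => M t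

end LoRAFloor

namespace LoRAFloor

/-! ### The Frobenius norm -/

section Frobenius

variable {p q s : ℕ}

/-! FFA-LoRA. With `A` frozen at `A⁰`, the loss of a layer is a quadratic in `B` whose Hessian acts
by right multiplication by `gram`, `G = (A⁰X)(A⁰X)ᵀ`, with spectrum in `[μ, β]`. If `Bhat` solves
the normal equation, Pythagoras splits the loss into a fixed residual and the excess `‖(B -
Bhat)A⁰X‖²`. The residual is comparable to the squared misalignment. From below, `BA⁰` is invisible
on the complement of the row space of `A⁰`, and `X` is bounded below (`Regime.misalign_floor`); from
above, `B⋆A⋆A⁰†` is a competitor (`Regime.frobSq_residual_le`). In the eigenbasis of `G` the excess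
decouples: the gradient noise is orthogonal in `L²` to the current iterate, so second moments obey
`s' = (1 - ηv)² s + η² c`. This contracts to a noise floor `ηβσ²/μ`, and converges when the noise
covariance does (`IsRun.ffa_layer`).

Layer-tied schedules. Take identity inputs, `W = a²EᵀE`, and factors scaled so that `ηa² = 1`: a
gradient step in one block is then an exact Newton step. If `BᵀW = 0` and `ηBᵀB = 1`, a first update
of `A` sends `A` to `0`, and `(0, B)` is a stationary point with the full loss `‖W‖²`; the situation
is symmetric for a first update of `B` when `WAᵀ = 0`. Let half of the layers be trapped by a first
`A`-round and the other half by a first `B`-round. Whatever block a tied schedule opens with, at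
least a third of the layers is lost (`IsFrame.isTrapped`, `le_three_mul_card_trapSet`). Over a fixed
horizon the dynamics is continuous in the noise, so with small noise the trapped layers stay near
their stationary points with probability at least one half (`IsTrapped.eventually_le`,
`IsRun.le_expectedRisk`). A layer-wise schedule opens each layer with its harmless block, which
makes `B` a multiple of `Eᵀ`; after that, descent in `A` is a linear contraction
(`IsFrame.frobSq_residual_contract`). -/

theorem frobSq_eq_trace (M : Matrix (Fin p) (Fin q) ℝ) : frobSq M = (Mᵀ * M).trace := by
  simp only [frobSq, Matrix.trace, Matrix.diag, Matrix.mul_apply, Matrix.transpose_apply]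
  rw [Finset.sum_comm]
  simp [sq]

theorem frobSq_nonneg (M : Matrix (Fin p) (Fin q) ℝ) : 0 ≤ frobSq M :=
  Finset.sum_nonneg fun _ _ => Finset.sum_nonneg fun _ _ => sq_nonneg _

theorem sq_le_frobSq (M : Matrix (Fin p) (Fin q) ℝ) (i : Fin p) (j : Fin q) :
    M i j ^ 2 ≤ frobSq M :=
  (Finset.single_le_sum (f := fun j => M i j ^ 2) (fun _ _ => sq_nonneg _)
    (Finset.mem_univ j)).trans
    (Finset.single_le_sum (f := fun i => ∑ j, M i j ^ 2)
      (fun _ _ => Finset.sum_nonneg fun _ _ => sq_nonneg _) (Finset.mem_univ i))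

theorem frobSq_eq_zero {M : Matrix (Fin p) (Fin q) ℝ} (h : frobSq M = 0) : M = 0 := by
  ext i j
  have := sq_le_frobSq M i j
  rw [h] at this
  exact pow_eq_zero_iff two_ne_zero |>.mp (le_antisymm this (sq_nonneg _))

theorem frobSq_zero : frobSq (0 : Matrix (Fin p) (Fin q) ℝ) = 0 := by simp [frobSq]

theorem frobSq_transpose (M : Matrix (Fin p) (Fin q) ℝ) : frobSq Mᵀ = frobSq M := by
  simp only [frobSq, Matrix.transpose_apply]
  exact Finset.sum_comm

theorem frobSq_smul (a : ℝ) (M : Matrix (Fin p) (Fin q) ℝ) : frobSq (a • M) = a ^ 2 * frobSq M := by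
  simp [frobSq, mul_pow, Finset.mul_sum]

theorem frobSq_neg (M : Matrix (Fin p) (Fin q) ℝ) : frobSq (-M) = frobSq M := by
  simp [frobSq]

theorem frobNorm_sq (M : Matrix (Fin p) (Fin q) ℝ) : frobNorm M ^ 2 = frobSq M :=
  Real.sq_sqrt (frobSq_nonneg M)

theorem trace_transpose_mul_comm (M K : Matrix (Fin p) (Fin q) ℝ) :
    (Mᵀ * K).trace = (Kᵀ * M).trace := by
  rw [← Matrix.trace_transpose, Matrix.transpose_mul, Matrix.transpose_transpose]

theorem frobSq_sub (M K : Matrix (Fin p) (Fin q) ℝ) :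
    frobSq (M - K) = frobSq M - 2 * (Mᵀ * K).trace + frobSq K := by
  simp only [frobSq_eq_trace, Matrix.transpose_sub, Matrix.sub_mul, Matrix.mul_sub,
    Matrix.trace_sub]
  rw [trace_transpose_mul_comm K M]
  ring

theorem frobSq_add_of_orthogonal {M K : Matrix (Fin p) (Fin q) ℝ} (h : (Mᵀ * K).trace = 0) :
    frobSq (M + K) = frobSq M + frobSq K := by
  have := frobSq_sub M (-K)
  simp only [sub_neg_eq_add, Matrix.mul_neg, Matrix.trace_neg, h, frobSq_neg] at this
  linarith

/-- Along a line the loss is a quadratic polynomial; gradient and Hessian are read off its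
coefficients. -/
theorem frobSq_sub_smul (R Y : Matrix (Fin p) (Fin q) ℝ) (x : ℝ) :
    frobSq (R - x • Y) = frobSq R - 2 * (Rᵀ * Y).trace * x + frobSq Y * x ^ 2 := by
  rw [frobSq_sub, frobSq_smul]
  simp only [Matrix.mul_smul, Matrix.trace_smul, smul_eq_mul]
  ring

/-- Right multiplication by a matrix with orthonormal rows preserves the Frobenius norm. -/
theorem frobSq_mul_of_mul_transpose_eq_one (M : Matrix (Fin p) (Fin q) ℝ)
    {U : Matrix (Fin q) (Fin s) ℝ} (hU : U * Uᵀ = 1) : frobSq (M * U) = frobSq M := by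
  rw [← frobSq_transpose, ← frobSq_transpose M, frobSq_eq_trace, frobSq_eq_trace]
  simp only [Matrix.transpose_mul, Matrix.transpose_transpose]
  rw [Matrix.mul_assoc, ← Matrix.mul_assoc U, hU, Matrix.one_mul]

/-- Right multiplication by the complement of an orthogonal projector is a contraction. -/
theorem frobSq_mul_one_sub_le (M : Matrix (Fin p) (Fin q) ℝ) {P : Matrix (Fin q) (Fin q) ℝ}
    (hs : Pᵀ = P) (hP : P * P = P) : frobSq (M * (1 - P)) ≤ frobSq M := by
  have h : ((M * (1 - P))ᵀ * (M * P)).trace = 0 := by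
    rw [Matrix.transpose_mul, Matrix.transpose_sub, hs, Matrix.transpose_one, Matrix.mul_assoc,
      Matrix.trace_mul_comm, Matrix.mul_assoc, Matrix.mul_assoc, Matrix.mul_sub, hP]
    simp
  have h2 := frobSq_add_of_orthogonal h
  rw [← Matrix.mul_add, sub_add_cancel, Matrix.mul_one] at h2
  linarith [frobSq_nonneg (M * P)]

theorem frobSq_eq_sum_dotProduct (M : Matrix (Fin p) (Fin q) ℝ) :
    frobSq M = ∑ i, M i ⬝ᵥ M i := by
  simp [frobSq, dotProduct, sq]

theorem frobSq_vecMulVec (x : Fin p → ℝ) (y : Fin q → ℝ) :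
    frobSq (vecMulVec x y) = (x ⬝ᵥ x) * (y ⬝ᵥ y) := by
  simp only [frobSq, vecMulVec_apply, dotProduct, Finset.sum_mul_sum]
  exact Finset.sum_congr rfl fun _ _ => Finset.sum_congr rfl fun _ _ => by ring

theorem mul_apply_row (M : Matrix (Fin p) (Fin q) ℝ) (X : Matrix (Fin q) (Fin s) ℝ) (i : Fin p) :
    (M * X) i = Xᵀ *ᵥ M i := by
  rw [Matrix.mulVec_transpose]
  rfl

end Frobenius

/-! ### Derivatives of quadratics along lines -/

section Quadratic

variable {p q k l : ℕ}

theorem hasDerivAt_half_frobSq_sub_smul (R Y : Matrix (Fin p) (Fin q) ℝ) (x : ℝ) :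
    HasDerivAt (fun x : ℝ => (1 / 2) * frobSq (R - x • Y))
      (-(Rᵀ * Y).trace + frobSq Y * x) x := by
  simp only [frobSq_sub_smul]
  have h := (((hasDerivAt_const x (frobSq R)).sub
    ((hasDerivAt_id x).const_mul (2 * (Rᵀ * Y).trace))).add
      (((hasDerivAt_id x).pow 2).const_mul (frobSq Y))).const_mul (1 / 2)
  refine (h.congr_deriv ?_)
  simp
  ring

theorem deriv_half_frobSq_sub_smul (R Y : Matrix (Fin p) (Fin q) ℝ) :
    deriv (fun x : ℝ => (1 / 2) * frobSq (R - x • Y)) = fun x => -(Rᵀ * Y).trace + frobSq Y * x :=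
  funext fun x => (hasDerivAt_half_frobSq_sub_smul R Y x).deriv

theorem iteratedDeriv_two_half_frobSq_sub_smul (R Y : Matrix (Fin p) (Fin q) ℝ) :
    iteratedDeriv 2 (fun x : ℝ => (1 / 2) * frobSq (R - x • Y)) 0 = frobSq Y := by
  rw [iteratedDeriv_succ, iteratedDeriv_one, deriv_half_frobSq_sub_smul]
  simp

theorem trace_mul_single (M : Matrix (Fin p) (Fin q) ℝ) (i : Fin q) (j : Fin p) :
    (M * Matrix.single i j (1 : ℝ)).trace = M j i := by
  rw [Matrix.trace_mul_single]
  simp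

/-- The gradient of `M ↦ ½ ‖C - K M L‖_F²`. -/
theorem matGrad_half_frobSq (C : Matrix (Fin k) (Fin l) ℝ) (K : Matrix (Fin k) (Fin p) ℝ)
    (L : Matrix (Fin q) (Fin l) ℝ) (M : Matrix (Fin p) (Fin q) ℝ) :
    matGrad (fun M => (1 / 2) * frobSq (C - K * M * L)) M = -(Kᵀ * (C - K * M * L) * Lᵀ) := by
  ext i j
  have h : ∀ x : ℝ, C - K * (M + x • Matrix.single i j (1 : ℝ)) * L =
      (C - K * M * L) - x • (K * Matrix.single i j (1 : ℝ) * L) := by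
    intro x
    simp only [Matrix.mul_add, Matrix.add_mul, Matrix.mul_smul, Matrix.smul_mul]
    abel
  simp only [matGrad, Matrix.of_apply, h, deriv_half_frobSq_sub_smul]
  rw [mul_zero, add_zero, Matrix.neg_apply, ← Matrix.mul_assoc, Matrix.trace_mul_comm,
    ← Matrix.mul_assoc, ← Matrix.mul_assoc, trace_mul_single]
  have ht : Kᵀ * (C - K * M * L) * Lᵀ = (L * (C - K * M * L)ᵀ * K)ᵀ := by
    simp only [Matrix.transpose_mul, Matrix.transpose_transpose, Matrix.mul_assoc]
  rw [ht, Matrix.transpose_apply]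

/-- The Hessian of `M ↦ ½ ‖C - K M L‖_F²`. -/
theorem hessForm_half_frobSq (C : Matrix (Fin k) (Fin l) ℝ) (K : Matrix (Fin k) (Fin p) ℝ)
    (L : Matrix (Fin q) (Fin l) ℝ) (M V : Matrix (Fin p) (Fin q) ℝ) :
    hessForm (fun M => (1 / 2) * frobSq (C - K * M * L)) M V = frobSq (K * V * L) := by
  have h : ∀ x : ℝ, C - K * (M + x • V) * L = (C - K * M * L) - x • (K * V * L) := by
    intro x
    simp only [Matrix.mul_add, Matrix.add_mul, Matrix.mul_smul, Matrix.smul_mul]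
    abel
  simp only [hessForm, h]
  exact iteratedDeriv_two_half_frobSq_sub_smul _ _

end Quadratic

namespace Config

variable {N d r m : ℕ} (P : Config N d r m) (n : Fin N)

/-- The identity factor on the left gives the shape `C - K * M * L` of the general gradient and
Hessian formulas. -/
theorem layerLoss_eq_B (A : Matrix (Fin r) (Fin d) ℝ) : (fun B => P.layerLoss n A B) =
    fun B => (1 / 2) * frobSq (P.Bstar n * P.Astar n * P.X n -
      (1 : Matrix (Fin d) (Fin d) ℝ) * B * (A * P.X n)) := by
  funext B
  simp [layerLoss, Matrix.mul_assoc]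

theorem matGrad_A (A : Matrix (Fin r) (Fin d) ℝ) (B : Matrix (Fin d) (Fin r) ℝ) :
    matGrad (fun A => P.layerLoss n A B) A =
      -(Bᵀ * (P.Bstar n * P.Astar n * P.X n - B * A * P.X n) * (P.X n)ᵀ) :=
  matGrad_half_frobSq _ _ _ _

theorem matGrad_B (A : Matrix (Fin r) (Fin d) ℝ) (B : Matrix (Fin d) (Fin r) ℝ) :
    matGrad (fun B => P.layerLoss n A B) B =
      -((P.Bstar n * P.Astar n * P.X n - B * A * P.X n) * (A * P.X n)ᵀ) := by
  rw [layerLoss_eq_B, matGrad_half_frobSq]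
  simp [Matrix.mul_assoc]

theorem hessForm_A (A V : Matrix (Fin r) (Fin d) ℝ) (B : Matrix (Fin d) (Fin r) ℝ) :
    hessForm (fun A => P.layerLoss n A B) A V = frobSq (B * V * P.X n) :=
  hessForm_half_frobSq _ _ _ _ _

theorem hessForm_B (A : Matrix (Fin r) (Fin d) ℝ) (B V : Matrix (Fin d) (Fin r) ℝ) :
    hessForm (fun B => P.layerLoss n A B) B V = frobSq (V * (A * P.X n)) := by
  rw [layerLoss_eq_B, hessForm_half_frobSq, Matrix.one_mul]

end Config

/-! ### Singular values -/

section Singular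

variable {p q : ℕ}

theorem toEuclideanLin_apply' (X : Matrix (Fin p) (Fin q) ℝ) (v : Fin q → ℝ) :
    Matrix.toEuclideanLin X (WithLp.toLp 2 v) = WithLp.toLp 2 (X *ᵥ v) := by
  simp

theorem adjoint_toEuclideanLin (X : Matrix (Fin p) (Fin q) ℝ) :
    LinearMap.adjoint (Matrix.toEuclideanLin X) = Matrix.toEuclideanLin Xᵀ := by
  rw [← Matrix.conjTranspose_eq_transpose_of_trivial]
  exact (Matrix.toEuclideanLin_conjTranspose_eq_adjoint X).symm

theorem exists_eigenvector_singularValues (X : Matrix (Fin p) (Fin q) ℝ) {i : ℕ} (hi : i < q) :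
    ∃ v : Fin q → ℝ, v ≠ 0 ∧
      Xᵀ *ᵥ (X *ᵥ v) = ((Matrix.toEuclideanLin X).singularValues i) ^ 2 • v := by
  obtain ⟨v, hv⟩ := ((Matrix.toEuclideanLin X).hasEigenvalue_adjoint_comp_self_sq_singularValues
    (n := i) (by simpa using hi)).exists_hasEigenvector
  refine ⟨WithLp.ofLp v, fun h => hv.2 (by simpa using h), ?_⟩
  have h := hv.apply_eq_smul
  rw [adjoint_toEuclideanLin] at h
  have h' := congrArg WithLp.ofLp h
  simpa using h'

theorem mulVec_dotProduct_mulVec (X : Matrix (Fin p) (Fin q) ℝ) (v w : Fin q → ℝ) :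
    (X *ᵥ v) ⬝ᵥ (X *ᵥ w) = v ⬝ᵥ (Xᵀ *ᵥ (X *ᵥ w)) := by
  rw [Matrix.dotProduct_mulVec, Matrix.dotProduct_mulVec, Matrix.vecMul_transpose,
    ← Matrix.dotProduct_mulVec]

theorem dotProduct_self_nonneg' (v : Fin q → ℝ) : 0 ≤ v ⬝ᵥ v :=
  Finset.sum_nonneg fun _ _ => mul_self_nonneg _

theorem dotProduct_self_pos {v : Fin q → ℝ} (hv : v ≠ 0) : 0 < v ⬝ᵥ v :=
  lt_of_le_of_ne (dotProduct_self_nonneg' v) fun h => hv (dotProduct_self_eq_zero.mp h.symm)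

theorem inner_toLp (v w : Fin q → ℝ) :
    inner ℝ (WithLp.toLp 2 v) (WithLp.toLp 2 w) = v ⬝ᵥ w := by
  simp [PiLp.inner_apply, dotProduct, mul_comm]

theorem mulVec_dotProduct_self_le (X : Matrix (Fin p) (Fin q) ℝ) (v : Fin q → ℝ) :
    (X *ᵥ v) ⬝ᵥ (X *ᵥ v) ≤ sigmaMax X ^ 2 * (v ⬝ᵥ v) := by
  rcases Nat.eq_zero_or_pos q with hq | hq
  · subst hq
    have : X *ᵥ v = 0 := by ext i; simp [Matrix.mulVec, dotProduct]
    simp [this, dotProduct]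
  set T := Matrix.toEuclideanLin X
  have hT := T.isSymmetric_adjoint_comp_self
  have hn : Module.finrank ℝ (EuclideanSpace ℝ (Fin q)) = q := by simp
  set b := hT.eigenvectorBasis hn
  set u : EuclideanSpace ℝ (Fin q) := WithLp.toLp 2 v
  have h1 : (X *ᵥ v) ⬝ᵥ (X *ᵥ v) = inner ℝ ((LinearMap.adjoint T ∘ₗ T) u) u := by
    rw [LinearMap.comp_apply, LinearMap.adjoint_inner_left, toEuclideanLin_apply', inner_toLp]
  have h2 : v ⬝ᵥ v = ∑ i, inner ℝ u (b i) * inner ℝ (b i) u := by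
    rw [b.sum_inner_mul_inner, inner_toLp]
  rw [h1, h2, ← b.sum_inner_mul_inner, Finset.mul_sum]
  refine Finset.sum_le_sum fun i _ => ?_
  rw [hT, hT.apply_eigenvectorBasis hn, inner_smul_right, mul_assoc]
  refine mul_le_mul_of_nonneg_right ?_ ?_
  -- In an eigenbasis of `XᵀX` it suffices to compare eigenvalues, and the one of index `0` is the
  -- largest.
  · have h0 : hT.eigenvalues hn i ≤ hT.eigenvalues hn ⟨0, hq⟩ :=
      hT.eigenvalues_antitone hn (Fin.mk_le_mk.mpr (Nat.zero_le _))
    have h3 := T.sq_singularValues_of_lt hn hq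
    rw [sigmaMax, h3]
    simpa using h0
  · rw [real_inner_comm]
    exact mul_self_nonneg _

/-- A matrix and its transpose have the same operator norm: by Cauchy–Schwarz, `|Xᵀy|⁴ ≤ |y|²
|XXᵀy|² ≤ |y|² σ² |Xᵀy|²`, and one factor `|Xᵀy|²` cancels. -/
theorem transpose_mulVec_dotProduct_self_le (X : Matrix (Fin p) (Fin q) ℝ) (y : Fin p → ℝ) :
    (Xᵀ *ᵥ y) ⬝ᵥ (Xᵀ *ᵥ y) ≤ sigmaMax X ^ 2 * (y ⬝ᵥ y) := by
  set a := (Xᵀ *ᵥ y) ⬝ᵥ (Xᵀ *ᵥ y) with ha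
  have h1 := mulVec_dotProduct_self_le X (Xᵀ *ᵥ y)
  have h2 : a = y ⬝ᵥ (X *ᵥ (Xᵀ *ᵥ y)) := by
    rw [ha, mulVec_dotProduct_mulVec, Matrix.transpose_transpose]
  set w := X *ᵥ (Xᵀ *ᵥ y)
  have h3 : a ^ 2 ≤ (y ⬝ᵥ y) * (w ⬝ᵥ w) := by
    rw [h2]
    have := Finset.sum_mul_sq_le_sq_mul_sq Finset.univ y w
    simpa [dotProduct, sq] using this
  have h0 : 0 ≤ a := dotProduct_self_nonneg' _
  rcases h0.eq_or_lt with h | h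
  · rw [← h]
    exact mul_nonneg (sq_nonneg _) (dotProduct_self_nonneg' _)
  · have h4 : a * a ≤ (sigmaMax X ^ 2 * (y ⬝ᵥ y)) * a := by
      nlinarith [mul_le_mul_of_nonneg_left h1 (dotProduct_self_nonneg' y)]
    exact le_of_mul_le_mul_right h4 h

/-- A top left singular vector. -/
theorem exists_transpose_mulVec_eq_sigmaMax (X : Matrix (Fin p) (Fin q) ℝ)
    (hX : 0 < sigmaMax X) : ∃ y : Fin p → ℝ, 0 < y ⬝ᵥ y ∧
      (Xᵀ *ᵥ y) ⬝ᵥ (Xᵀ *ᵥ y) = sigmaMax X ^ 2 * (y ⬝ᵥ y) := by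
  have hq : 0 < q := by
    by_contra h
    have h0 : sigmaMax X = 0 :=
      (Matrix.toEuclideanLin X).singularValues_of_finrank_le (by simp; omega)
    exact hX.ne' h0
  obtain ⟨v, hv, he⟩ := exists_eigenvector_singularValues X hq
  change _ = sigmaMax X ^ 2 • v at he
  have h1 : (X *ᵥ v) ⬝ᵥ (X *ᵥ v) = sigmaMax X ^ 2 * (v ⬝ᵥ v) := by
    rw [mulVec_dotProduct_mulVec, he, dotProduct_smul, smul_eq_mul]
  refine ⟨X *ᵥ v, ?_, ?_⟩
  · rw [h1]
    exact mul_pos (pow_pos hX 2) (dotProduct_self_pos hv)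
  · rw [he, h1, smul_dotProduct, dotProduct_smul, smul_eq_mul, smul_eq_mul]

theorem frobSq_mul_le_sigmaMax {k : ℕ} (M : Matrix (Fin k) (Fin p) ℝ)
    (X : Matrix (Fin p) (Fin q) ℝ) : frobSq (M * X) ≤ sigmaMax X ^ 2 * frobSq M := by
  rw [frobSq_eq_sum_dotProduct, frobSq_eq_sum_dotProduct, Finset.mul_sum]
  refine Finset.sum_le_sum fun i _ => ?_
  rw [mul_apply_row]
  exact transpose_mulVec_dotProduct_self_le X _

/-- If `MᵀM = a² I` then the singular values of `M` are all equal to `a`. -/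
theorem singularValues_eq_of_transpose_mul_self {X : Matrix (Fin p) (Fin q) ℝ} {a : ℝ}
    (ha : 0 ≤ a) (hX : Xᵀ * X = a ^ 2 • (1 : Matrix (Fin q) (Fin q) ℝ)) {i : ℕ} (hi : i < q) :
    (Matrix.toEuclideanLin X).singularValues i = a := by
  obtain ⟨v, hv, he⟩ := exists_eigenvector_singularValues X hi
  rw [Matrix.mulVec_mulVec, hX, Matrix.smul_mulVec, Matrix.one_mulVec] at he
  have h := smul_left_injective ℝ hv he
  exact ((sq_eq_sq₀ ha (LinearMap.singularValues_nonneg _ _)).mp h).symm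

end Singular

/-! ### Geometry of a layer with frozen down-projection -/

theorem rowProj_transpose {p q : ℕ} (M : Matrix (Fin p) (Fin q) ℝ) :
    (rowProj M)ᵀ = rowProj M := (pinv_spec M).symm_right

theorem rowProj_mul_self {p q : ℕ} (M : Matrix (Fin p) (Fin q) ℝ) :
    rowProj M * rowProj M = rowProj M := by
  rw [rowProj, ← Matrix.mul_assoc, (pinv_spec M).self_mul_mul]

theorem mul_rowProj {p q : ℕ} (M : Matrix (Fin p) (Fin q) ℝ) : M * rowProj M = M := by
  rw [rowProj, ← Matrix.mul_assoc, (pinv_spec M).mul_mul_self]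

namespace Config

variable {N d r m : ℕ} (P : Config N d r m)

theorem misalign_sq (n : Fin N) :
    P.misalign n ^ 2 = frobSq (P.Bstar n * P.Astar n * (1 - rowProj (P.A0 n))) :=
  frobNorm_sq _

/-- The Hessian of the `B`-block at the frozen down-projection. -/
noncomputable def gram (n : Fin N) : Matrix (Fin r) (Fin r) ℝ :=
  (P.A0 n * P.X n) * (P.A0 n * P.X n)ᵀ

theorem gram_isHermitian (n : Fin N) : (P.gram n).IsHermitian := by
  rw [Matrix.IsHermitian, Matrix.conjTranspose_eq_transpose_of_trivial, gram]
  simp [Matrix.transpose_mul]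

variable {P} {κ μ β sLo sHi : ℝ}

theorem Regime.width_pos (h : P.Regime κ μ β sLo sHi) (hs : 0 < sLo) (n : Fin N) : 0 < d := by
  by_contra hd
  obtain rfl : d = 0 := by omega
  have h0 : Matrix.toEuclideanLin (P.X n) = 0 := by
    ext v i
    exact i.elim0
  have h1 := (h.scale n).1
  rw [sigmaMax, h0, LinearMap.singularValues_zero] at h1
  exact absurd h1 (not_le.mpr hs)

/-- For `r = 0` the right side of the conditioning assumption is `0`, whereas the inputs have
positive norm. -/
theorem Regime.rank_pos (h : P.Regime κ μ β sLo sHi) (hs : 0 < sLo) (n : Fin N) : 0 < r := by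
  by_contra hr
  obtain rfl : r = 0 := by omega
  have h1 := h.conditioned n
  have h0 : sigmaMinPos ((P.X n)ᵀ * pinv (P.A0 n)) = 0 :=
    LinearMap.singularValues_of_finrank_le _ (by simp)
  rw [h0, mul_zero] at h1
  linarith [(h.scale n).1]

theorem Regime.frobSq_mul_bounds (h : P.Regime κ μ β sLo sHi) (n : Fin N)
    (V : Matrix (Fin d) (Fin r) ℝ) :
    μ * frobSq V ≤ frobSq (V * (P.A0 n * P.X n)) ∧
      frobSq (V * (P.A0 n * P.X n)) ≤ β * frobSq V := by
  have := h.hessB_init n 0 V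
  rwa [hessForm_B] at this

theorem frobSq_vecMulVec_mul (n : Fin N) (x : Fin d → ℝ) (v : Fin r → ℝ) :
    frobSq (vecMulVec x v * (P.A0 n * P.X n)) = (x ⬝ᵥ x) * (v ⬝ᵥ (P.gram n *ᵥ v)) := by
  rw [Matrix.vecMulVec_mul, frobSq_vecMulVec, gram, ← Matrix.mulVec_mulVec,
    Matrix.dotProduct_mulVec]
  congr 2
  rw [Matrix.mulVec_transpose]

/-- Eigenvalues of the Hessian lie between `μ` and `β`. -/
theorem Regime.eigenvalue_bounds (h : P.Regime κ μ β sLo sHi) (hs : 0 < sLo) (n : Fin N)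
    {v : Fin r → ℝ} (hv : v ≠ 0) {a : ℝ} (ha : P.gram n *ᵥ v = a • v) : μ ≤ a ∧ a ≤ β := by
  have hd := h.width_pos hs n
  have hx : (Pi.single (⟨0, hd⟩ : Fin d) (1 : ℝ)) ⬝ᵥ (Pi.single (⟨0, hd⟩ : Fin d) (1 : ℝ)) = 1 := by
    simp
  -- A rank-one test direction with a unit left factor turns the bound on `d × r` matrices into one
  -- on `v`.
  obtain ⟨h1, h2⟩ := h.frobSq_mul_bounds n (vecMulVec (Pi.single (⟨0, hd⟩ : Fin d) (1 : ℝ)) v)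
  rw [frobSq_vecMulVec_mul, frobSq_vecMulVec, hx, ha, dotProduct_smul, smul_eq_mul, one_mul,
    one_mul] at h1 h2
  have hp := dotProduct_self_pos hv
  exact ⟨le_of_mul_le_mul_right h1 hp, le_of_mul_le_mul_right h2 hp⟩

/-- The inputs span the whole space, with a quantitative bound. -/
theorem Regime.le_frobSq_mul_X (h : P.Regime κ μ β sLo sHi) (hs : 0 < sLo) (hβ : 0 < β)
    (n : Fin N) {k : ℕ} (M : Matrix (Fin k) (Fin d) ℝ) :
    μ * sLo ^ 2 / β * frobSq M ≤ frobSq (M * P.X n) := by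
  have hr := h.rank_pos hs n
  have hsig : 0 < sigmaMax (P.X n) := hs.trans_le (h.scale n).1
  obtain ⟨y, hy, hye⟩ := exists_transpose_mulVec_eq_sigmaMax (P.X n) hsig
  set b : Fin r → ℝ := Pi.single (⟨0, hr⟩ : Fin r) (1 : ℝ)
  have hb : b ⬝ᵥ b = 1 := by simp [b]
  set w := P.Bstar n *ᵥ b
  have key : ∀ z : Fin d → ℝ, frobSq (P.Bstar n * vecMulVec b z * P.X n) =
      (w ⬝ᵥ w) * (((P.X n)ᵀ *ᵥ z) ⬝ᵥ ((P.X n)ᵀ *ᵥ z)) := by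
    intro z
    rw [Matrix.mul_vecMulVec, Matrix.vecMulVec_mul, frobSq_vecMulVec, Matrix.mulVec_transpose]
  -- On rank-one directions `b zᵀ` the `A`-Hessian is `|w|² |Xᵀz|²` with the same `w = B⋆b` for all
  -- `z`. The upper bound at the top singular direction `y` limits `|w|²`; the lower bound at
  -- arbitrary `z` then bounds `Xᵀ` from below.
  have hH : ∀ z : Fin d → ℝ,
      μ * (z ⬝ᵥ z) ≤ (w ⬝ᵥ w) * (((P.X n)ᵀ *ᵥ z) ⬝ᵥ ((P.X n)ᵀ *ᵥ z)) ∧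
      (w ⬝ᵥ w) * (((P.X n)ᵀ *ᵥ z) ⬝ᵥ ((P.X n)ᵀ *ᵥ z)) ≤ β * (z ⬝ᵥ z) := by
    intro z
    have := h.hessA_opt n (vecMulVec b z)
    rwa [hessForm_A, key, frobSq_vecMulVec, hb, one_mul] at this
  have hw0 : 0 ≤ w ⬝ᵥ w := dotProduct_self_nonneg' w
  have hw : (w ⬝ᵥ w) * sLo ^ 2 ≤ β := by
    have h1 := (hH y).2
    rw [hye, ← mul_assoc] at h1
    refine (mul_le_mul_of_nonneg_left ?_ hw0).trans (le_of_mul_le_mul_right h1 hy)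
    exact pow_le_pow_left₀ hs.le (h.scale n).1 2
  rw [frobSq_eq_sum_dotProduct, frobSq_eq_sum_dotProduct, Finset.mul_sum]
  refine Finset.sum_le_sum fun i _ => ?_
  rw [mul_apply_row]
  have h1 := (hH (M i)).1
  have h2 : 0 ≤ ((P.X n)ᵀ *ᵥ M i) ⬝ᵥ ((P.X n)ᵀ *ᵥ M i) := dotProduct_self_nonneg' _
  rw [div_mul_eq_mul_div, div_le_iff₀ hβ]
  calc μ * sLo ^ 2 * (M i ⬝ᵥ M i) = sLo ^ 2 * (μ * (M i ⬝ᵥ M i)) := by ring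
    _ ≤ sLo ^ 2 * ((w ⬝ᵥ w) * (((P.X n)ᵀ *ᵥ M i) ⬝ᵥ ((P.X n)ᵀ *ᵥ M i))) :=
        mul_le_mul_of_nonneg_left h1 (sq_nonneg _)
    _ = ((w ⬝ᵥ w) * sLo ^ 2) * (((P.X n)ᵀ *ᵥ M i) ⬝ᵥ ((P.X n)ᵀ *ᵥ M i)) := by ring
    _ ≤ β * (((P.X n)ᵀ *ᵥ M i) ⬝ᵥ ((P.X n)ᵀ *ᵥ M i)) := mul_le_mul_of_nonneg_right hw h2
    _ = _ := mul_comm _ _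

/-- No factor paired with the frozen down-projection beats the misalignment floor. -/
theorem Regime.misalign_floor (h : P.Regime κ μ β sLo sHi) (hs : 0 < sLo) (hμ : 0 < μ)
    (hβ : 0 < β) (n : Fin N) (B : Matrix (Fin d) (Fin r) ℝ) :
    μ * sLo ^ 2 / β * P.misalign n ^ 2 ≤
      frobSq (P.Bstar n * P.Astar n * P.X n - B * P.A0 n * P.X n) := by
  rw [← Matrix.sub_mul]
  refine le_trans (mul_le_mul_of_nonneg_left ?_ (by positivity)) (h.le_frobSq_mul_X hs hβ n _)
  rw [misalign_sq]
  have h1 := frobSq_mul_one_sub_le (P.Bstar n * P.Astar n - B * P.A0 n)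
    (rowProj_transpose (P.A0 n)) (rowProj_mul_self _)
  -- The complementary projector annihilates `B * A⁰`, so the floor does not depend on `B`.
  have h2 : (P.Bstar n * P.Astar n - B * P.A0 n) * (1 - rowProj (P.A0 n)) =
      P.Bstar n * P.Astar n * (1 - rowProj (P.A0 n)) := by
    rw [Matrix.sub_mul _ (B * P.A0 n), Matrix.mul_assoc B, Matrix.mul_sub (P.A0 n), mul_rowProj]
    simp
  rwa [h2] at h1

/-- The Hessian is diagonalised by an orthogonal matrix, its normal equation has a solution. -/
theorem Regime.exists_diagonalization (h : P.Regime κ μ β sLo sHi) (hs : 0 < sLo) (hμ : 0 < μ)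
    (n : Fin N) : ∃ (U : Matrix (Fin r) (Fin r) ℝ) (v : Fin r → ℝ) (Bhat : Matrix (Fin d) (Fin r) ℝ),
      U * Uᵀ = 1 ∧ P.gram n = U * diagonal v * Uᵀ ∧ (∀ k, μ ≤ v k ∧ v k ≤ β) ∧
      (P.Bstar n * P.Astar n * P.X n - Bhat * P.A0 n * P.X n) * (P.A0 n * P.X n)ᵀ = 0 := by
  have hG := P.gram_isHermitian n
  have hsp := hG.spectral_theorem
  rw [Unitary.conjStarAlgAut_apply] at hsp
  set U : Matrix (Fin r) (Fin r) ℝ := (hG.eigenvectorUnitary : Matrix (Fin r) (Fin r) ℝ)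
  have hU : U * star U = 1 := Unitary.coe_mul_star_self hG.eigenvectorUnitary
  have hst : star U = Uᵀ := by ext i j; simp [Matrix.star_apply]
  rw [hst] at hU
  have hU' : Uᵀ * U = 1 := mul_eq_one_comm.mp hU
  set v := hG.eigenvalues
  have hs' : P.gram n = U * diagonal v * Uᵀ := by
    rw [hsp, ← hst]; rfl
  have hv : ∀ k, μ ≤ v k ∧ v k ≤ β := by
    intro k
    have h1 : P.gram n *ᵥ (U *ᵥ Pi.single k 1) = v k • (U *ᵥ Pi.single k 1) := by
      rw [Matrix.mulVec_mulVec]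
      conv_lhs => rw [hs', Matrix.mul_assoc, hU', Matrix.mul_one, ← Matrix.mulVec_mulVec]
      rw [← Matrix.mulVec_smul]
      congr 1
      ext i
      rw [Matrix.mulVec_diagonal]
      by_cases hik : i = k
      · subst hik; simp
      · simp [hik]
    refine h.eigenvalue_bounds hs n ?_ h1
    intro h0
    have h2 := congrArg (fun w => Uᵀ *ᵥ w) h0
    simp only [Matrix.mulVec_mulVec, hU', Matrix.one_mulVec, Matrix.mulVec_zero] at h2
    have h3 := congrFun h2 k
    simp at h3
  -- The least-squares solution, with the inverse of `gram` written in its eigenbasis.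
  refine ⟨U, v, P.Bstar n * P.Astar n * P.X n * (P.A0 n * P.X n)ᵀ *
    (U * diagonal (fun k => (v k)⁻¹) * Uᵀ), hU, hs', hv, ?_⟩
  have h1 : (U * diagonal (fun k => (v k)⁻¹) * Uᵀ) * P.gram n = 1 := by
    calc _ = U * diagonal (fun k => (v k)⁻¹) * (Uᵀ * U) * diagonal v * Uᵀ := by
          rw [hs']; simp only [Matrix.mul_assoc]
      _ = 1 := by
          rw [hU', Matrix.mul_one, Matrix.mul_assoc U, diagonal_mul_diagonal]
          have : (fun k => (v k)⁻¹ * v k) = fun _ => 1 := by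
            ext k
            exact inv_mul_cancel₀ (hμ.trans_le (hv k).1).ne'
          rw [this, diagonal_one, Matrix.mul_one, hU]
  generalize (U * diagonal (fun k => (v k)⁻¹) * Uᵀ) = K at h1
  rw [Matrix.sub_mul, sub_eq_zero]
  have h2 := congrArg (fun Z => P.Bstar n * P.Astar n * P.X n * (P.A0 n * P.X n)ᵀ * Z) h1
  simp only [Matrix.mul_one] at h2
  rw [gram] at h2
  refine h2.symm.trans ?_
  simp only [Matrix.mul_assoc]

/-- Pythagoras for the least-squares problem in `B`. -/
theorem frobSq_residual_eq (n : Fin N) {Bhat : Matrix (Fin d) (Fin r) ℝ}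
    (hB : (P.Bstar n * P.Astar n * P.X n - Bhat * P.A0 n * P.X n) * (P.A0 n * P.X n)ᵀ = 0)
    (B : Matrix (Fin d) (Fin r) ℝ) :
    frobSq (P.Bstar n * P.Astar n * P.X n - B * P.A0 n * P.X n) =
      frobSq (P.Bstar n * P.Astar n * P.X n - Bhat * P.A0 n * P.X n) +
        frobSq ((B - Bhat) * (P.A0 n * P.X n)) := by
  set R := P.Bstar n * P.Astar n * P.X n - Bhat * P.A0 n * P.X n
  have h1 : P.Bstar n * P.Astar n * P.X n - B * P.A0 n * P.X n =
      R + -((B - Bhat) * (P.A0 n * P.X n)) := by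
    simp only [R, Matrix.sub_mul, Matrix.mul_assoc]
    abel
  rw [h1, frobSq_add_of_orthogonal, frobSq_neg]
  rw [trace_transpose_mul_comm, Matrix.trace_mul_comm, Matrix.transpose_neg, Matrix.mul_neg,
    Matrix.transpose_mul, ← Matrix.mul_assoc, hB]
  simp

/-- By Pythagoras `Bhat` is a minimiser, so it does no worse than `B⋆A⋆A⁰†`, whose residual is
exactly `B⋆A⋆(1 - P)X`. -/
theorem Regime.frobSq_residual_le (h : P.Regime κ μ β sLo sHi) (hs : 0 < sLo) (n : Fin N)
    {Bhat : Matrix (Fin d) (Fin r) ℝ}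
    (hB : (P.Bstar n * P.Astar n * P.X n - Bhat * P.A0 n * P.X n) * (P.A0 n * P.X n)ᵀ = 0) :
    frobSq (P.Bstar n * P.Astar n * P.X n - Bhat * P.A0 n * P.X n) ≤
      sHi ^ 2 * P.misalign n ^ 2 := by
  have h1 := frobSq_residual_eq n hB (P.Bstar n * P.Astar n * pinv (P.A0 n))
  have h2 : P.Bstar n * P.Astar n * P.X n - P.Bstar n * P.Astar n * pinv (P.A0 n) * P.A0 n * P.X n
      = P.Bstar n * P.Astar n * (1 - rowProj (P.A0 n)) * P.X n := by
    rw [rowProj]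
    simp only [Matrix.mul_sub, Matrix.sub_mul, Matrix.mul_one, Matrix.mul_assoc]
  rw [h2] at h1
  have h3 := frobSq_mul_le_sigmaMax (P.Bstar n * P.Astar n * (1 - rowProj (P.A0 n))) (P.X n)
  have h4 : sigmaMax (P.X n) ^ 2 ≤ sHi ^ 2 :=
    pow_le_pow_left₀ (hs.le.trans (h.scale n).1) (h.scale n).2 2
  rw [misalign_sq]
  linarith [frobSq_nonneg ((P.Bstar n * P.Astar n * pinv (P.A0 n) - Bhat) * (P.A0 n * P.X n)),
    mul_le_mul_of_nonneg_right h4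
      (frobSq_nonneg (P.Bstar n * P.Astar n * (1 - rowProj (P.A0 n))))]

/-- The excess risk in the eigenbasis of the Hessian. -/
theorem frobSq_mul_gram_eq (n : Fin N) {U : Matrix (Fin r) (Fin r) ℝ} {v : Fin r → ℝ}
    (hs : P.gram n = U * diagonal v * Uᵀ) (E : Matrix (Fin d) (Fin r) ℝ) :
    frobSq (E * (P.A0 n * P.X n)) = ∑ k, v k * ∑ i, (E * U) i k ^ 2 := by
  have h1 : frobSq (E * (P.A0 n * P.X n)) = (diagonal v * ((E * U)ᵀ * (E * U))).trace := by
    rw [← frobSq_transpose, frobSq_eq_trace, Matrix.transpose_transpose, Matrix.transpose_mul E,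
      Matrix.mul_assoc, ← Matrix.mul_assoc (P.A0 n * P.X n)]
    change (E * (P.gram n * Eᵀ)).trace = _
    rw [hs, Matrix.transpose_mul, Matrix.trace_mul_comm]
    calc _ = (U * (diagonal v * Uᵀ * Eᵀ * E)).trace := by simp only [Matrix.mul_assoc]
      _ = (diagonal v * Uᵀ * Eᵀ * E * U).trace := Matrix.trace_mul_comm _ _
      _ = _ := by simp only [Matrix.mul_assoc]
  rw [h1, Matrix.trace]
  refine Finset.sum_congr rfl fun k _ => ?_
  rw [Matrix.diag_apply, Matrix.diagonal_mul, Matrix.mul_apply]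
  simp only [Matrix.transpose_apply, sq]

end Config

/-! ### Scalar recursions -/

/-- The level `L` is a supersolution of the recursion, and the excess over it shrinks by `ρ` in each
step. -/
theorem recursion_le {x : ℕ → ℝ} {ρ b L : ℝ} (hρ : 0 ≤ ρ) (hL : ρ * L + b ≤ L)
    (hx : ∀ t, x (t + 1) ≤ ρ * x t + b) (t : ℕ) : x t ≤ ρ ^ t * |x 0 - L| + L := by
  induction t with
  | zero => linarith [le_abs_self (x 0 - L)]
  | succ t ih =>
    have h1 := mul_le_mul_of_nonneg_left ih hρ
    rw [pow_succ']
    linarith [hx t]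

theorem tendsto_of_recursion {x b : ℕ → ℝ} {ρ q : ℝ} (hρ : 0 ≤ ρ) (hρ1 : ρ < 1)
    (hx : ∀ t, x (t + 1) = ρ * x t + b t) (hb : Tendsto b atTop (𝓝 q)) :
    Tendsto x atTop (𝓝 (q / (1 - ρ))) := by
  have h1ρ : 0 < 1 - ρ := by linarith
  rw [Metric.tendsto_atTop]
  intro ε hε
  obtain ⟨t₀, ht₀⟩ := Metric.tendsto_atTop.mp hb ((1 - ρ) * (ε / 2)) (by positivity)
  set l := q / (1 - ρ) with hl
  have hq : q = l - ρ * l := by rw [hl]; field_simp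
  -- Past `t₀` the distance to the limit is driven by at most `(1 - ρ)ε/2`, a forcing whose fixed
  -- point is `ε/2`.
  have h1 : ∀ t, |x (t₀ + t) - l| ≤ ρ ^ t * |(|x t₀ - l|) - ε / 2| + ε / 2 := by
    refine recursion_le (x := fun t => |x (t₀ + t) - l|) (b := (1 - ρ) * (ε / 2)) hρ
      (by linarith) fun t => ?_
    have h2 : x (t₀ + (t + 1)) - l = ρ * (x (t₀ + t) - l) + (b (t₀ + t) - q) := by
      rw [← add_assoc, hx, hq]; ring
    have h3 := ht₀ (t₀ + t) (Nat.le_add_right _ _)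
    rw [Real.dist_eq] at h3
    rw [h2]
    refine (abs_add_le _ _).trans ?_
    rw [abs_mul, abs_of_nonneg hρ]
    linarith
  have h4 : Tendsto (fun t => ρ ^ t * |(|x t₀ - l|) - ε / 2|) atTop (𝓝 0) := by
    simpa using (tendsto_pow_atTop_nhds_zero_of_lt_one hρ hρ1).mul_const |(|x t₀ - l|) - ε / 2|
  obtain ⟨t₁, ht₁⟩ := Metric.tendsto_atTop.mp h4 (ε / 2) (by positivity)
  refine ⟨t₀ + t₁, fun t ht => ?_⟩
  obtain ⟨k, rfl⟩ := Nat.exists_eq_add_of_le (show t₀ ≤ t by omega)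
  have h5 := ht₁ k (by omega)
  rw [Real.dist_eq, sub_zero] at h5
  rw [Real.dist_eq]
  linarith [h1 k, le_abs_self (ρ ^ k * |(|x t₀ - l|) - ε / 2|)]

/-! ### Square-integrable martingale increments -/

section Increments

variable {Ω : Type*} {past : MeasurableSpace Ω} [mΩ : MeasurableSpace Ω] {prob : Measure Ω}

theorem memLp_sum_mul_const {k : ℕ} {f : Fin k → Ω → ℝ} (hf : ∀ j, MemLp (f j) 2 prob)
    (a : Fin k → ℝ) : MemLp (fun ω => ∑ j, f j ω * a j) 2 prob :=
  memLp_finsetSum _ fun j _ => (hf j).mul_const (a j)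

theorem integral_sq_sub_of_orthogonal {y z : Ω → ℝ} (hy : MemLp y 2 prob) (hz : MemLp z 2 prob)
    (h : ∫ ω, y ω * z ω ∂prob = 0) (a b : ℝ) :
    ∫ ω, (a * y ω - b * z ω) ^ 2 ∂prob =
      a ^ 2 * ∫ ω, y ω ^ 2 ∂prob + b ^ 2 * ∫ ω, z ω ^ 2 ∂prob := by
  have e : ∀ ω, (a * y ω - b * z ω) ^ 2 =
      (a ^ 2 * y ω ^ 2 + b ^ 2 * z ω ^ 2) - 2 * a * b * (y ω * z ω) := fun ω => by ring
  have i1 : Integrable (fun ω => a ^ 2 * y ω ^ 2) prob := hy.integrable_sq.const_mul _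
  have i2 : Integrable (fun ω => b ^ 2 * z ω ^ 2) prob := hz.integrable_sq.const_mul _
  have i3 : Integrable (fun ω => 2 * a * b * (y ω * z ω)) prob :=
    (hy.integrable_mul hz).const_mul _
  simp only [e]
  rw [integral_sub (f := fun ω => a ^ 2 * y ω ^ 2 + b ^ 2 * z ω ^ 2) (i1.add i2) i3, integral_add i1 i2, integral_const_mul, integral_const_mul,
    integral_const_mul, h]
  ring

variable {σ : ℝ} {p q : ℕ} {g G : Ω → Matrix (Fin p) (Fin q) ℝ}

/-- The entries of the gradient noise are square-integrable when the mean is integrable. -/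
theorem IsStochGrad.memLp_noise (h : IsStochGrad prob past σ g G)
    (hG : ∀ i j, Integrable (fun ω => G ω i j) prob) (i : Fin p) (j : Fin q) :
    MemLp (fun ω => (g ω - G ω) i j) 2 prob := by
  have hm : AEStronglyMeasurable (fun ω => (g ω - G ω) i j) prob :=
    ((h.integrable i j).sub (hG i j)).aestronglyMeasurable
  rw [memLp_two_iff_integrable_sq hm]
  refine h.integrable_sq.mono' (hm.pow 2) (ae_of_all _ fun ω => ?_)
  rw [Real.norm_eq_abs, abs_of_nonneg (sq_nonneg _)]
  exact sq_le_frobSq _ i j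

variable [IsProbabilityMeasure prob]

/-- A square-integrable variable with vanishing conditional mean is orthogonal to the past. -/
theorem integral_mul_eq_zero_of_condExp (hp : past ≤ mΩ) {y z : Ω → ℝ}
    (hy : Measurable[past] y) (hy2 : MemLp y 2 prob) (hz : MemLp z 2 prob)
    (hc : prob[z | past] =ᵐ[prob] 0) : ∫ ω, y ω * z ω ∂prob = 0 := by
  have hi : Integrable (y * z) prob := hy2.integrable_mul hz
  have h1 := condExp_mul_of_stronglyMeasurable_left (m := past) (μ := prob)
    hy.stronglyMeasurable hi (hz.integrable one_le_two)
  have h2 : ∫ ω, (prob[y * z | past]) ω ∂prob = ∫ ω, (y * z) ω ∂prob := integral_condExp hp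
  have h3 : prob[y * z | past] =ᵐ[prob] 0 := by
    filter_upwards [h1, hc] with ω h4 h5
    rw [h4, Pi.mul_apply, h5]
    simp
  rw [integral_congr_ae h3] at h2
  simpa using h2.symm

theorem IsStochGrad.condExp_noise (h : IsStochGrad prob past σ g G) (hp : past ≤ mΩ)
    (hG : ∀ i j, Integrable (fun ω => G ω i j) prob)
    (hGm : ∀ i j, Measurable[past] fun ω => G ω i j) (i : Fin p) (j : Fin q) :
    prob[fun ω => (g ω - G ω) i j | past] =ᵐ[prob] 0 := by
  have h1 := condExp_sub (m := past) (h.integrable i j) (hG i j)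
  have h2 : prob[fun ω => G ω i j | past] = fun ω => G ω i j :=
    condExp_of_stronglyMeasurable hp (hGm i j).stronglyMeasurable (hG i j)
  filter_upwards [h1, h.unbiased i j] with ω h3 h4
  refine h3.trans ?_
  rw [Pi.sub_apply, h4, h2]
  simp

end Increments

/-! ### FFA-LoRA runs -/

section FFA

/-- Centred at the least-squares solution the gradient is linear: the normal equation removes the
constant term. -/
theorem Config.matGrad_frozen_eq {N d r m : ℕ} (P : Config N d r m) (n : Fin N)
    {Bhat : Matrix (Fin d) (Fin r) ℝ}
    (hB : (P.Bstar n * P.Astar n * P.X n - Bhat * P.A0 n * P.X n) * (P.A0 n * P.X n)ᵀ = 0)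
    (B : Matrix (Fin d) (Fin r) ℝ) :
    matGrad (fun B' => P.layerLoss n (P.A0 n) B') B = (B - Bhat) * P.gram n := by
  rw [P.matGrad_B, Config.gram]
  have h1 : P.Bstar n * P.Astar n * P.X n - B * P.A0 n * P.X n =
      (P.Bstar n * P.Astar n * P.X n - Bhat * P.A0 n * P.X n) -
        (B - Bhat) * (P.A0 n * P.X n) := by
    simp only [Matrix.sub_mul, Matrix.mul_assoc]
    abel
  rw [h1, Matrix.sub_mul, hB, zero_sub, neg_neg, Matrix.mul_assoc]

variable {Ω : Type*} [mΩ : MeasurableSpace Ω] {prob : Measure Ω}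
  {N d r m : ℕ} {P : Config N d r m} {η σ : ℝ} {ℱ : Filtration ℕ mΩ}
  {A : ℕ → Ω → Fin N → Matrix (Fin r) (Fin d) ℝ} {B : ℕ → Ω → Fin N → Matrix (Fin d) (Fin r) ℝ}
  {gA : ℕ → Ω → Fin N → Matrix (Fin r) (Fin d) ℝ} {gB : ℕ → Ω → Fin N → Matrix (Fin d) (Fin r) ℝ}

theorem IsRun.ffa_A_eq (h : IsRun prob P η σ (ffaMode N) ℱ A B gA gB) (t : ℕ) (ω : Ω) (n : Fin N) :
    A t ω n = P.A0 n := by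
  induction t with
  | zero => exact (h.init ω n).1
  | succ t ih => rw [(h.step_B t n rfl ω).1, ih]

theorem IsRun.ffa_isStochGrad (h : IsRun prob P η σ (ffaMode N) ℱ A B gA gB) (t : ℕ) (n : Fin N)
    {Bhat : Matrix (Fin d) (Fin r) ℝ}
    (hB : (P.Bstar n * P.Astar n * P.X n - Bhat * P.A0 n * P.X n) * (P.A0 n * P.X n)ᵀ = 0) :
    IsStochGrad prob (ℱ t) σ (fun ω => gB t ω n) (fun ω => (B t ω n - Bhat) * P.gram n) := by
  have h1 := h.grad_B t n rfl
  simp only [h.ffa_A_eq, P.matGrad_frozen_eq n hB] at h1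
  exact h1

theorem IsRun.measurable_mul (h : IsRun prob P η σ (ffaMode N) ℱ A B gA gB) (t : ℕ) (n : Fin N)
    (Bhat : Matrix (Fin d) (Fin r) ℝ) {k : ℕ} (K : Matrix (Fin r) (Fin k) ℝ) (i : Fin d)
    (j : Fin k) : Measurable[ℱ t] fun ω => ((B t ω n - Bhat) * K) i j := by
  simp only [Matrix.mul_apply, Matrix.sub_apply]
  exact Finset.measurable_sum _ fun l _ =>
    Measurable.mul_const (Measurable.sub_const (h.adapted_B t n i l) _) _

variable [IsProbabilityMeasure prob]

/-- Square integrability is only assumed for the noise. It passes to the iterates by induction,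
since the start is deterministic and the mean gradient is linear in the iterate. -/
theorem IsRun.memLp_B (h : IsRun prob P η σ (ffaMode N) ℱ A B gA gB) (n : Fin N)
    {Bhat : Matrix (Fin d) (Fin r) ℝ}
    (hB : (P.Bstar n * P.Astar n * P.X n - Bhat * P.A0 n * P.X n) * (P.A0 n * P.X n)ᵀ = 0)
    (t : ℕ) (i : Fin d) (j : Fin r) : MemLp (fun ω => (B t ω n - Bhat) i j) 2 prob := by
  induction t generalizing i j with
  | zero =>
    have : (fun ω => (B 0 ω n - Bhat) i j) = fun _ => (P.B0 n - Bhat) i j := by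
      funext ω
      rw [(h.init ω n).2]
    rw [this]
    exact memLp_const _
  | succ t ih =>
    have hG : ∀ i j, MemLp (fun ω => ((B t ω n - Bhat) * P.gram n) i j) 2 prob := by
      intro i j
      simp only [Matrix.mul_apply]
      exact memLp_sum_mul_const (fun l => ih i l) _
    have h1 := (h.ffa_isStochGrad t n hB).memLp_noise (fun i j => (hG i j).integrable one_le_two) i j
    have h2 : (fun ω => (B (t + 1) ω n - Bhat) i j) = fun ω => (B t ω n - Bhat) i j -
        η * (((B t ω n - Bhat) * P.gram n) i j +
          (gB t ω n - (B t ω n - Bhat) * P.gram n) i j) := by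
      funext ω
      rw [(h.step_B t n rfl ω).2]
      simp only [Matrix.sub_apply, Matrix.smul_apply, smul_eq_mul]
      ring
    rw [h2]
    exact (ih i j).sub (((hG i j).add h1).const_mul η)

variable {κ μ β sLo sHi : ℝ}

/-- In FFA-LoRA the expected loss of a layer is a fixed floor plus an excess obeying a contracting
recursion driven by the noise covariance. -/
theorem IsRun.ffa_layer (h : IsRun prob P η σ (ffaMode N) ℱ A B gA gB)
    (hP : P.Regime κ μ β sLo sHi) (hs : 0 < sLo) (hμ : 0 < μ) (hβ : 0 < β) (hη : 0 < η)
    (hηβ : η * β ≤ 1) (n : Fin N) :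
    ∃ (f : ℝ) (b : ℕ → ℝ), μ * sLo ^ 2 / β * P.misalign n ^ 2 ≤ f ∧
      f ≤ sHi ^ 2 * P.misalign n ^ 2 ∧
      (∀ t, Integrable (fun ω => frobSq (P.Bstar n * P.Astar n * P.X n -
        B t ω n * A t ω n * P.X n)) prob) ∧
      (∀ t, ∫ ω, frobSq (P.Bstar n * P.Astar n * P.X n - B t ω n * A t ω n * P.X n) ∂prob =
        f + b t) ∧
      (∀ t, 0 ≤ b t) ∧
      (∀ t, b (t + 1) ≤ (1 - η * μ) * b t + η ^ 2 * β * σ ^ 2) ∧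
      (NoiseCovConverges prob P A B gB → ∃ l, Tendsto b atTop (𝓝 l)) := by
  obtain ⟨U, v, Bhat, hU, hdiag, hv, hB⟩ := hP.exists_diagonalization hs hμ n
  have hU' : Uᵀ * U = 1 := mul_eq_one_comm.mp hU
  set ξ : ℕ → Ω → Matrix (Fin d) (Fin r) ℝ :=
    fun t ω => gB t ω n - (B t ω n - Bhat) * P.gram n with hξ
  have hGL : ∀ t i j, MemLp (fun ω => ((B t ω n - Bhat) * P.gram n) i j) 2 prob := by
    intro t i j
    simp only [Matrix.mul_apply]
    exact memLp_sum_mul_const (fun l => h.memLp_B n hB t i l) _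
  have hGI : ∀ t i j, Integrable (fun ω => ((B t ω n - Bhat) * P.gram n) i j) prob :=
    fun t i j => (hGL t i j).integrable one_le_two
  have hξL : ∀ t i j, MemLp (fun ω => ξ t ω i j) 2 prob := fun t i j =>
    (h.ffa_isStochGrad t n hB).memLp_noise (hGI t) i j
  have hYL : ∀ t i k, MemLp (fun ω => ((B t ω n - Bhat) * U) i k) 2 prob := by
    intro t i k
    simp only [Matrix.mul_apply]
    exact memLp_sum_mul_const (fun l => h.memLp_B n hB t i l) _
  have hZL : ∀ t i k, MemLp (fun ω => (ξ t ω * U) i k) 2 prob := by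
    intro t i k
    simp only [Matrix.mul_apply]
    exact memLp_sum_mul_const (fun l => hξL t i l) _
  -- Unbiasedness enters here: the iterate is measurable with respect to the past and the noise has
  -- conditional mean zero.
  have horth : ∀ t i k, ∫ ω, ((B t ω n - Bhat) * U) i k * (ξ t ω * U) i k ∂prob = 0 := by
    intro t i k
    have h1 : ∀ j, ∫ ω, ((B t ω n - Bhat) * U) i k * ξ t ω i j ∂prob = 0 := fun j =>
      integral_mul_eq_zero_of_condExp (ℱ.le t) (h.measurable_mul t n Bhat U i k) (hYL t i k)
        (hξL t i j) ((h.ffa_isStochGrad t n hB).condExp_noise (ℱ.le t) (hGI t)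
          (fun i j => h.measurable_mul t n Bhat (P.gram n) i j) i j)
    have h2 : ∀ ω, ((B t ω n - Bhat) * U) i k * (ξ t ω * U) i k =
        ∑ j, (((B t ω n - Bhat) * U) i k * ξ t ω i j) * U j k := by
      intro ω
      rw [Matrix.mul_apply (M := ξ t ω), Finset.mul_sum]
      exact Finset.sum_congr rfl fun _ _ => (mul_assoc _ _ _).symm
    simp only [h2]
    have h3 : ∀ j, Integrable (fun ω => ((B t ω n - Bhat) * U) i k * ξ t ω i j * U j k) prob :=
      fun j => ((hYL t i k).integrable_mul (hξL t i j)).mul_const _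
    rw [integral_finsetSum _ fun j _ => h3 j]
    refine Finset.sum_eq_zero fun j _ => ?_
    rw [integral_mul_const, h1, zero_mul]
  -- In the eigenbasis of the Hessian every coordinate evolves by itself.
  have hstep : ∀ t ω i k, ((B (t + 1) ω n - Bhat) * U) i k =
      (1 - η * v k) * ((B t ω n - Bhat) * U) i k - η * (ξ t ω * U) i k := by
    intro t ω i k
    have h1 : B (t + 1) ω n - Bhat =
        (B t ω n - Bhat) - η • ((B t ω n - Bhat) * P.gram n) - η • ξ t ω := by
      rw [(h.step_B t n rfl ω).2, hξ]
      simp only [smul_sub]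
      abel
    have h2 : ((B t ω n - Bhat) * P.gram n) * U = ((B t ω n - Bhat) * U) * diagonal v := by
      rw [hdiag]
      simp only [Matrix.mul_assoc, hU', Matrix.mul_one]
    rw [h1, Matrix.sub_mul, Matrix.sub_mul, Matrix.smul_mul, Matrix.smul_mul, h2]
    simp only [Matrix.sub_apply, Matrix.smul_apply, Matrix.mul_diagonal, smul_eq_mul]
    ring
  set s : Fin r → ℕ → ℝ := fun k t => ∑ i, ∫ ω, ((B t ω n - Bhat) * U) i k ^ 2 ∂prob with hsdef
  set c : Fin r → ℕ → ℝ := fun k t => ∑ i, ∫ ω, (ξ t ω * U) i k ^ 2 ∂prob with hcdef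
  have hs0 : ∀ k t, 0 ≤ s k t := fun k t =>
    Finset.sum_nonneg fun i _ => integral_nonneg fun ω => sq_nonneg _
  have hc0 : ∀ k t, 0 ≤ c k t := fun k t =>
    Finset.sum_nonneg fun i _ => integral_nonneg fun ω => sq_nonneg _
  have hrec : ∀ k t, s k (t + 1) = (1 - η * v k) ^ 2 * s k t + η ^ 2 * c k t := by
    intro k t
    simp only [hsdef, hcdef, hstep, Finset.mul_sum]
    rw [← Finset.sum_add_distrib]
    exact Finset.sum_congr rfl fun i _ =>
      integral_sq_sub_of_orthogonal (hYL t i k) (hZL t i k) (horth t i k) _ _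
  have hvar : ∀ t, ∑ k, c k t ≤ σ ^ 2 := by
    intro t
    refine le_trans (le_of_eq ?_) (h.ffa_isStochGrad t n hB).variance_le
    have h1 : ∀ ω, frobSq (gB t ω n - (B t ω n - Bhat) * P.gram n) =
        ∑ k, ∑ i, (ξ t ω * U) i k ^ 2 := by
      intro ω
      rw [← frobSq_mul_of_mul_transpose_eq_one _ hU, frobSq, Finset.sum_comm]
    simp only [h1]
    rw [integral_finsetSum _ fun k _ => integrable_finsetSum _ fun i _ =>
      (hZL t i k).integrable_sq]
    refine Finset.sum_congr rfl fun k _ => ?_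
    rw [integral_finsetSum _ fun i _ => (hZL t i k).integrable_sq]
  -- The forcing `c k` is the `k`-th diagonal entry of `Uᵀ 𝔼[ξᵀξ] U`, a fixed linear function of the
  -- covariance.
  have hcov : NoiseCovConverges prob P A B gB → ∀ k, ∃ l, Tendsto (c k) atTop (𝓝 l) := by
    intro hn k
    have hn' := hn n
    simp only [h.ffa_A_eq, P.matGrad_frozen_eq n hB] at hn'
    choose Q hQ using hn'
    have h1 : ∀ t ω, ∑ i, (ξ t ω * U) i k ^ 2 =
        ∑ j, ∑ l, ((ξ t ω)ᵀ * ξ t ω) j l * (U j k * U l k) := by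
      intro t ω
      have h2 : ∑ i, (ξ t ω * U) i k ^ 2 = (Uᵀ * ((ξ t ω)ᵀ * ξ t ω) * U) k k := by
        have : Uᵀ * ((ξ t ω)ᵀ * ξ t ω) * U = (ξ t ω * U)ᵀ * (ξ t ω * U) := by
          simp only [Matrix.transpose_mul, Matrix.mul_assoc]
        rw [this, Matrix.mul_apply]
        simp only [Matrix.transpose_apply, sq]
      rw [h2, Matrix.mul_apply]
      simp only [Matrix.mul_apply (M := Uᵀ), Finset.sum_mul, Matrix.transpose_apply U]
      rw [Finset.sum_comm]
      exact Finset.sum_congr rfl fun _ _ => Finset.sum_congr rfl fun _ _ => by ring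
    have hi : ∀ t j l, Integrable (fun ω => ((ξ t ω)ᵀ * ξ t ω) j l) prob := by
      intro t j l
      simp only [Matrix.mul_apply, Matrix.transpose_apply]
      exact integrable_finsetSum _ fun i _ => (hξL t i j).integrable_mul (hξL t i l)
    have h3 : c k = fun t => ∑ j, ∑ l, (∫ ω, ((ξ t ω)ᵀ * ξ t ω) j l ∂prob) * (U j k * U l k) := by
      funext t
      rw [hcdef]
      dsimp only
      rw [← integral_finsetSum _ fun i _ => (hZL t i k).integrable_sq]
      simp only [h1]
      rw [integral_finsetSum _ fun j _ => integrable_finsetSum _ fun l _ =>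
        (hi t j l).mul_const _]
      refine Finset.sum_congr rfl fun j _ => ?_
      rw [integral_finsetSum _ fun l _ => (hi t j l).mul_const _]
      exact Finset.sum_congr rfl fun l _ => integral_mul_const _ _
    refine ⟨∑ j, ∑ l, Q j l * (U j k * U l k), ?_⟩
    rw [h3]
    exact tendsto_finsetSum _ fun j _ => tendsto_finsetSum _ fun l _ => (hQ j l).mul_const _
  have hηv : ∀ k, 0 ≤ 1 - η * v k ∧ 1 - η * v k ≤ 1 - η * μ ∧ 1 - η * v k < 1 := by
    intro k
    have h1 := mul_le_mul_of_nonneg_left (hv k).1 hη.le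
    have h2 := mul_le_mul_of_nonneg_left (hv k).2 hη.le
    have h3 := mul_pos hη hμ
    exact ⟨by linarith, by linarith, by linarith⟩
  have hint : ∀ t k, Integrable (fun ω => v k * ∑ i, ((B t ω n - Bhat) * U) i k ^ 2) prob :=
    fun t k => (integrable_finsetSum _ fun i _ => (hYL t i k).integrable_sq).const_mul _
  have hres : ∀ t ω, frobSq (P.Bstar n * P.Astar n * P.X n - B t ω n * A t ω n * P.X n) =
      frobSq (P.Bstar n * P.Astar n * P.X n - Bhat * P.A0 n * P.X n) +
        ∑ k, v k * ∑ i, ((B t ω n - Bhat) * U) i k ^ 2 := by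
    intro t ω
    rw [h.ffa_A_eq, Config.frobSq_residual_eq n hB, Config.frobSq_mul_gram_eq n hdiag]
  refine ⟨frobSq (P.Bstar n * P.Astar n * P.X n - Bhat * P.A0 n * P.X n),
    fun t => ∑ k, v k * s k t, hP.misalign_floor hs hμ hβ n Bhat, hP.frobSq_residual_le hs n hB,
    ?_, ?_, ?_, ?_, ?_⟩
  · intro t
    simp only [hres]
    exact (integrable_const _).add (integrable_finsetSum _ fun k _ => hint t k)
  · intro t
    simp only [hres]
    rw [integral_add (integrable_const _) (integrable_finsetSum _ fun k _ => hint t k),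
      integral_finsetSum _ fun k _ => hint t k]
    simp only [integral_const, probReal_univ, one_smul, integral_const_mul]
    congr 1
    refine Finset.sum_congr rfl fun k _ => ?_
    rw [integral_finsetSum _ fun i _ => (hYL t i k).integrable_sq]
  · exact fun t => Finset.sum_nonneg fun k _ => mul_nonneg (hμ.le.trans (hv k).1) (hs0 k t)
  · intro t
    have h1 : ∀ k, v k * s k (t + 1) ≤ (1 - η * μ) * (v k * s k t) + η ^ 2 * β * c k t := by
      intro k
      obtain ⟨ha, hb, hc⟩ := hηv k
      have hv0 : 0 ≤ v k := hμ.le.trans (hv k).1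
      -- Since `0 ≤ 1 - ηv ≤ 1`, squaring only decreases it; this is where `ηβ ≤ 1` is needed.
      have h2 : (1 - η * v k) ^ 2 ≤ 1 - η * μ := by nlinarith
      have h3 := mul_le_mul_of_nonneg_right h2 (mul_nonneg hv0 (hs0 k t))
      have h4 := mul_le_mul_of_nonneg_right (hv k).2 (mul_nonneg (sq_nonneg η) (hc0 k t))
      rw [hrec]
      nlinarith
    calc ∑ k, v k * s k (t + 1)
        ≤ ∑ k, ((1 - η * μ) * (v k * s k t) + η ^ 2 * β * c k t) := Finset.sum_le_sum fun k _ => h1 k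
      _ = (1 - η * μ) * ∑ k, v k * s k t + η ^ 2 * β * ∑ k, c k t := by
          rw [Finset.sum_add_distrib, Finset.mul_sum, Finset.mul_sum]
      _ ≤ _ := by
          have := mul_le_mul_of_nonneg_left (hvar t) (by positivity : 0 ≤ η ^ 2 * β)
          linarith
  · intro hn
    choose l hl using hcov hn
    have h1 : ∀ k, Tendsto (s k) atTop (𝓝 (η ^ 2 * l k / (1 - (1 - η * v k) ^ 2))) := by
      intro k
      obtain ⟨ha, hb, hc⟩ := hηv k
      exact tendsto_of_recursion (sq_nonneg _) (by nlinarith) (hrec k) ((hl k).const_mul _)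
    exact ⟨_, tendsto_finsetSum _ fun k _ => (h1 k).const_mul (v k)⟩

theorem ffa_floor (κ μ β sLo sHi : ℝ) (hμ : 0 < μ) (hβ : 0 < β) (hs : 0 < sLo)
    (hsHi : 0 < sHi) :
    ∃ c C : ℝ, 0 < c ∧ 0 < C ∧
      ∀ (N d r m : ℕ) (P : Config N d r m), P.Regime κ μ β sLo sHi →
      ∀ η σ : ℝ, 0 < η → η * β ≤ 1 → 0 ≤ σ →
      ∀ (Ω : Type*) [mΩ : MeasurableSpace Ω] (prob : Measure Ω) [IsProbabilityMeasure prob]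
        (ℱ : Filtration ℕ mΩ)
        (A : ℕ → Ω → Fin N → Matrix (Fin r) (Fin d) ℝ)
        (B : ℕ → Ω → Fin N → Matrix (Fin d) (Fin r) ℝ)
        (gA : ℕ → Ω → Fin N → Matrix (Fin r) (Fin d) ℝ)
        (gB : ℕ → Ω → Fin N → Matrix (Fin d) (Fin r) ℝ),
      IsRun prob P η σ (ffaMode N) ℱ A B gA gB →
        ENNReal.ofReal (c * P.meanSqMisalign) ≤ liminf (expectedRisk prob P A B) atTop ∧
          limsup (expectedRisk prob P A B) atTop ≤
            ENNReal.ofReal (C * (P.meanSqMisalign + η * σ ^ 2)) ∧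
          (NoiseCovConverges prob P A B gB →
            ∃ l : ℝ, Tendsto (expectedRisk prob P A B) atTop (𝓝 (ENNReal.ofReal l)) ∧
              c * P.meanSqMisalign ≤ l ∧ l ≤ C * (P.meanSqMisalign + η * σ ^ 2)) := by
  -- The summand `sHi²` pays for the least-squares residual and `β/μ` for the noise floor `ηβσ²/μ`.
  refine ⟨μ * sLo ^ 2 / β, sHi ^ 2 + β / μ, by positivity, by positivity, ?_⟩
  intro N d r m P hP η σ hη hηβ hσ Ω mΩ prob _ ℱ A B gA gB h
  choose f b hf1 hf2 hint hval hb0 hb hconv using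
    fun n => h.ffa_layer hP hs hμ hβ hη hηβ n
  have hN : 0 ≤ 1 / (N : ℝ) := by positivity
  set ρ : ℕ → ℝ := fun t => 1 / (N : ℝ) * ∑ n, (f n + b n t) with hρ
  have hrisk : expectedRisk prob P A B = fun t => ENNReal.ofReal (ρ t) := by
    funext t
    rw [expectedRisk, ← ofReal_integral_eq_lintegral_ofReal]
    · congr 1
      simp only [Config.risk]
      rw [integral_const_mul, integral_finsetSum _ fun n _ => hint n t, hρ]
      simp only [hval]
    · exact (integrable_finsetSum _ fun n _ => hint n t).const_mul _
    · exact ae_of_all _ fun ω => mul_nonneg hN (Finset.sum_nonneg fun n _ => frobSq_nonneg _)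
  have hlow : ∀ t, μ * sLo ^ 2 / β * P.meanSqMisalign ≤ ρ t := by
    intro t
    rw [Config.meanSqMisalign, mul_left_comm, Finset.mul_sum]
    exact mul_le_mul_of_nonneg_left
      (Finset.sum_le_sum fun n _ => by linarith [hf1 n, hb0 n t]) hN
  set L := η * β * σ ^ 2 / μ with hL
  have hbt : ∀ n t, b n t ≤ (1 - η * μ) ^ t * |b n 0 - L| + L ∧ 0 ≤ 1 - η * μ := by
    intro n t
    obtain ⟨U, v, -, -, -, hv, -⟩ := hP.exists_diagonalization hs hμ n
    -- An actual eigenvalue, available because `r > 0`, gives `μ ≤ β` and hence a nonnegative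
    -- contraction factor.
    have hv0 := hv ⟨0, hP.rank_pos hs n⟩
    have h1 : 0 ≤ 1 - η * μ := by
      have := mul_le_mul_of_nonneg_left (hv0.1.trans hv0.2) hη.le
      linarith
    refine ⟨recursion_le h1 (le_of_eq ?_) (hb n) t, h1⟩
    rw [hL]
    field_simp
    ring
  set u : ℕ → ℝ := fun t => 1 / (N : ℝ) * ∑ n, (sHi ^ 2 * P.misalign n ^ 2 +
    ((1 - η * μ) ^ t * |b n 0 - L| + L)) with hu
  have hup : ∀ t, ρ t ≤ u t := fun t => mul_le_mul_of_nonneg_left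
    (Finset.sum_le_sum fun n _ => add_le_add (hf2 n) (hbt n t).1) hN
  have hulim : Tendsto u atTop (𝓝 (1 / (N : ℝ) * ∑ n, (sHi ^ 2 * P.misalign n ^ 2 + L))) := by
    refine (tendsto_finsetSum _ fun n _ => tendsto_const_nhds.add ?_).const_mul _
    have h1 := (tendsto_pow_atTop_nhds_zero_of_lt_one (hbt n 0).2
      (by linarith [mul_pos hη hμ])).mul_const |b n 0 - L|
    simpa using h1.add_const L
  have hfin : 1 / (N : ℝ) * ∑ n, (sHi ^ 2 * P.misalign n ^ 2 + L) ≤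
      (sHi ^ 2 + β / μ) * (P.meanSqMisalign + η * σ ^ 2) := by
    have hL0 : 0 ≤ L := by positivity
    have h1 : 1 / (N : ℝ) * ∑ n : Fin N, (sHi ^ 2 * P.misalign n ^ 2 + L) =
        sHi ^ 2 * P.meanSqMisalign + (1 / (N : ℝ) * N) * L := by
      rw [Finset.sum_add_distrib, ← Finset.mul_sum, Config.meanSqMisalign]
      simp
      ring
    -- Only an inequality: for `N = 0` the factor is `0`.
    have h2 : (1 / (N : ℝ) * N) * L ≤ L := by
      refine mul_le_of_le_one_left hL0 ?_
      rw [one_div]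
      exact inv_mul_le_one
    have h3 : L = β / μ * (η * σ ^ 2) := by rw [hL]; ring
    have h4 : 0 ≤ P.meanSqMisalign :=
      mul_nonneg hN (Finset.sum_nonneg fun n _ => sq_nonneg _)
    have h5 : 0 ≤ β / μ * P.meanSqMisalign := by positivity
    have h6 : 0 ≤ sHi ^ 2 * (η * σ ^ 2) := by positivity
    rw [h1]
    linarith
  refine ⟨?_, ?_, ?_⟩
  · rw [hrisk]
    exact le_liminf_of_le (by isBoundedDefault)
      (Eventually.of_forall fun t => ENNReal.ofReal_le_ofReal (hlow t))
  · rw [hrisk]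
    calc limsup (fun t => ENNReal.ofReal (ρ t)) atTop
        ≤ limsup (fun t => ENNReal.ofReal (u t)) atTop :=
          limsup_le_limsup (Eventually.of_forall fun t => ENNReal.ofReal_le_ofReal (hup t))
      _ = ENNReal.ofReal (1 / (N : ℝ) * ∑ n, (sHi ^ 2 * P.misalign n ^ 2 + L)) :=
          (ENNReal.tendsto_ofReal hulim).limsup_eq
      _ ≤ _ := ENNReal.ofReal_le_ofReal hfin
  · intro hn
    choose l hl using fun n => hconv n hn
    have h1 : Tendsto ρ atTop (𝓝 (1 / (N : ℝ) * ∑ n, (f n + l n))) :=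
      (tendsto_finsetSum _ fun n _ => tendsto_const_nhds.add (hl n)).const_mul _
    refine ⟨_, by rw [hrisk]; exact ENNReal.tendsto_ofReal h1, ge_of_tendsto' h1 hlow, ?_⟩
    exact (le_of_tendsto_of_tendsto' h1 hulim hup).trans hfin

end FFA

/-! ### Noisy alternating descent near a stationary point -/

section Trajectory

variable {d r : ℕ}

/-- One round of noisy block gradient descent on `½ ‖W - BA‖_F²`. -/
noncomputable def noisyStep (η : ℝ) (W : Matrix (Fin d) (Fin d) ℝ) (k : Block)
    (x ξ : Matrix (Fin r) (Fin d) ℝ × Matrix (Fin d) (Fin r) ℝ) :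
    Matrix (Fin r) (Fin d) ℝ × Matrix (Fin d) (Fin r) ℝ :=
  match k with
  | Block.A => (x.1 + η • (x.2ᵀ * (W - x.2 * x.1)) - η • ξ.1, x.2)
  | Block.B => (x.1, x.2 + η • ((W - x.2 * x.1) * x.1ᵀ) - η • ξ.2)

theorem continuous_noisyStep (η : ℝ) (W : Matrix (Fin d) (Fin d) ℝ) (k : Block) :
    Continuous fun y : (Matrix (Fin r) (Fin d) ℝ × Matrix (Fin d) (Fin r) ℝ) ×
      (Matrix (Fin r) (Fin d) ℝ × Matrix (Fin d) (Fin r) ℝ) => noisyStep η W k y.1 y.2 := by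
  cases k <;> simp only [noisyStep] <;> fun_prop

theorem continuous_frobSq {p q : ℕ} :
    Continuous fun M : Matrix (Fin p) (Fin q) ℝ => frobSq M := by
  simp only [frobSq]
  fun_prop

theorem eventually_frobSq_lt_mem {p q : ℕ} {O : Set (Matrix (Fin p) (Fin q) ℝ)}
    (hO : O ∈ 𝓝 (0 : Matrix (Fin p) (Fin q) ℝ)) :
    ∀ᶠ δ in 𝓝[>] (0 : ℝ), ∀ M : Matrix (Fin p) (Fin q) ℝ, frobSq M < δ → M ∈ O := by
  have hO' : O ∈ 𝓝 (0 : Fin p → Fin q → ℝ) := hO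
  obtain ⟨ε, hε, hb⟩ := Metric.mem_nhds_iff.mp hO'
  filter_upwards [Ioo_mem_nhdsGT (pow_pos hε 2)] with δ hδ M hM
  refine hb ((dist_pi_lt_iff hε).mpr fun i => (dist_pi_lt_iff hε).mpr fun j => ?_)
  rw [Real.dist_eq]
  have h1 : M i j ^ 2 < ε ^ 2 := (sq_le_frobSq M i j).trans_lt (hM.trans hδ.2)
  simpa using abs_lt_of_sq_lt_sq h1 hε.le

/-- Round `t` of `x` is a noisy step of the block `M t` with noise below `δ`. -/
def IsNoisyTrajectory (η : ℝ) (W : Matrix (Fin d) (Fin d) ℝ) (δ : ℝ) (T : ℕ) (M : ℕ → Block)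
    (x : ℕ → Matrix (Fin r) (Fin d) ℝ × Matrix (Fin d) (Fin r) ℝ) : Prop :=
  ∀ t < T, ∃ ξ, frobSq ξ.1 < δ ∧ frobSq ξ.2 < δ ∧ x (t + 1) = noisyStep η W (M t) (x t) ξ

/-- Joint continuity of the step at zero noise; one noise level serves all starting points in `V`.
-/
theorem eventually_noisyStep_mem {η : ℝ} {W : Matrix (Fin d) (Fin d) ℝ} {k : Block}
    {y : Matrix (Fin r) (Fin d) ℝ × Matrix (Fin d) (Fin r) ℝ}
    {U : Set (Matrix (Fin r) (Fin d) ℝ × Matrix (Fin d) (Fin r) ℝ)}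
    (hU : U ∈ 𝓝 (noisyStep η W k y 0)) :
    ∃ V ∈ 𝓝 y, ∀ᶠ δ in 𝓝[>] (0 : ℝ), ∀ x ∈ V, ∀ ξ, frobSq ξ.1 < δ → frobSq ξ.2 < δ →
      noisyStep η W k x ξ ∈ U := by
  have h1 := (continuous_noisyStep (r := r) η W k).continuousAt (x := (y, 0)) hU
  rw [Filter.mem_map, nhds_prod_eq, Filter.mem_prod_iff] at h1
  obtain ⟨V, hV, O, hO, hVO⟩ := h1
  have hO' : O ∈ 𝓝 ((0 : Matrix (Fin r) (Fin d) ℝ), (0 : Matrix (Fin d) (Fin r) ℝ)) := hO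
  rw [nhds_prod_eq, Filter.mem_prod_iff] at hO'
  obtain ⟨O₁, hO₁, O₂, hO₂, hOO⟩ := hO'
  refine ⟨V, hV, ?_⟩
  filter_upwards [eventually_frobSq_lt_mem hO₁, eventually_frobSq_lt_mem hO₂] with
    δ hδ₁ hδ₂ x hx ξ hξ₁ hξ₂
  have h2 : ξ ∈ O := hOO (Set.mk_mem_prod (hδ₁ _ hξ₁) (hδ₂ _ hξ₂))
  exact hVO (Set.mk_mem_prod hx h2)

/-- Trajectories with small noise started near a stationary point stay near it. -/
theorem exists_nhds_trajectory_mem {η : ℝ} {W : Matrix (Fin d) (Fin d) ℝ}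
    {z : Matrix (Fin r) (Fin d) ℝ × Matrix (Fin d) (Fin r) ℝ}
    (hz : ∀ k, noisyStep η W k z 0 = z) (T : ℕ) :
    ∀ U ∈ 𝓝 z, ∃ V ∈ 𝓝 z, ∀ᶠ δ in 𝓝[>] (0 : ℝ), ∀ M x, x 0 ∈ V →
      IsNoisyTrajectory η W δ T M x → x T ∈ U := by
  induction T with
  | zero => exact fun U hU => ⟨U, hU, Eventually.of_forall fun _ _ _ h _ => h⟩
  | succ T ih =>
    intro U hU
    have h1 : ∀ k, ∃ V ∈ 𝓝 z, ∀ᶠ δ in 𝓝[>] (0 : ℝ), ∀ x ∈ V, ∀ ξ, frobSq ξ.1 < δ →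
        frobSq ξ.2 < δ → noisyStep η W k x ξ ∈ U := fun k =>
      eventually_noisyStep_mem (by rwa [hz k])
    obtain ⟨VA, hVA, hA⟩ := h1 Block.A
    obtain ⟨VB, hVB, hB⟩ := h1 Block.B
    -- There are only two blocks, so intersecting makes the neighbourhood independent of the
    -- schedule.
    obtain ⟨V, hV, hVT⟩ := ih (VA ∩ VB) (Filter.inter_mem hVA hVB)
    refine ⟨V, hV, ?_⟩
    filter_upwards [hA, hB, hVT] with δ hδA hδB hδ M x hx0 hx
    have h2 := hδ M x hx0 fun t ht => hx t (ht.trans (Nat.lt_succ_self T))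
    obtain ⟨ξ, hξ₁, hξ₂, he⟩ := hx T (Nat.lt_succ_self T)
    rw [he]
    cases M T with
    | A => exact hδA _ h2.1 ξ hξ₁ hξ₂
    | B => exact hδB _ h2.2 ξ hξ₁ hξ₂

theorem noisyStep_eq_self {η : ℝ} {W : Matrix (Fin d) (Fin d) ℝ}
    {z : Matrix (Fin r) (Fin d) ℝ × Matrix (Fin d) (Fin r) ℝ}
    (h1 : z.2ᵀ * W = 0) (h2 : W * z.1ᵀ = 0) (h3 : z.2 * z.1 = 0) (k : Block) :
    noisyStep η W k z 0 = z := by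
  cases k <;> simp [noisyStep, h1, h2, h3]

/-- `(A, B)` is sent by the first round to a stationary point at which `BA = 0`. -/
def IsTrapped (η : ℝ) (W : Matrix (Fin d) (Fin d) ℝ) (k : Block)
    (x : Matrix (Fin r) (Fin d) ℝ × Matrix (Fin d) (Fin r) ℝ) : Prop :=
  frobSq W ≤ frobSq (W - x.2 * x.1) ∧ ∃ z, noisyStep η W k x 0 = z ∧
    z.2ᵀ * W = 0 ∧ W * z.1ᵀ = 0 ∧ z.2 * z.1 = 0

/-- The first round lands near the stationary point `z` and the remaining rounds stay there; the
loss at `z` is `‖W‖²`, so half of it survives on a neighbourhood. The noise level depends on `T`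
because stationary points need not be stable. -/
theorem IsTrapped.eventually_le {η : ℝ} {W : Matrix (Fin d) (Fin d) ℝ} (hW : 0 < frobSq W)
    {k : Block} {y : Matrix (Fin r) (Fin d) ℝ × Matrix (Fin d) (Fin r) ℝ}
    (hy : IsTrapped η W k y) (T : ℕ) :
    ∀ᶠ δ in 𝓝[>] (0 : ℝ), ∀ (M : ℕ → Block)
      (x : ℕ → Matrix (Fin r) (Fin d) ℝ × Matrix (Fin d) (Fin r) ℝ), M 0 = k → x 0 = y →
      IsNoisyTrajectory η W δ T M x → frobSq W / 2 ≤ frobSq (W - (x T).2 * (x T).1) := by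
  obtain ⟨h0, z, hz, h1, h2, h3⟩ := hy
  cases T with
  | zero =>
    refine Eventually.of_forall fun δ M x _ hx _ => ?_
    rw [hx]
    linarith
  | succ T =>
    have hU : {x : Matrix (Fin r) (Fin d) ℝ × Matrix (Fin d) (Fin r) ℝ |
        frobSq W / 2 < frobSq (W - x.2 * x.1)} ∈ 𝓝 z := by
      have hc : Continuous fun x : Matrix (Fin r) (Fin d) ℝ × Matrix (Fin d) (Fin r) ℝ =>
          frobSq (W - x.2 * x.1) := continuous_frobSq.comp (by fun_prop)
      refine (isOpen_lt continuous_const hc).mem_nhds ?_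
      simp only [Set.mem_ofPred_eq, h3, sub_zero]
      linarith
    obtain ⟨V, hV, hVT⟩ := exists_nhds_trajectory_mem (η := η) (noisyStep_eq_self h1 h2 h3) T _ hU
    obtain ⟨V', hV', hs⟩ := eventually_noisyStep_mem (η := η) (W := W) (k := k) (y := y)
      (by rwa [hz])
    filter_upwards [hVT, hs] with δ hδ hδ' M x hM hx0 hx
    refine le_of_lt (hδ (fun t => M (t + 1)) (fun t => x (t + 1)) ?_
      fun t ht => hx (t + 1) (by omega))
    obtain ⟨ξ, hξ₁, hξ₂, he⟩ := hx 0 (Nat.succ_pos T)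
    simp only [zero_add] at he ⊢
    rw [he, hM, hx0]
    exact hδ' _ (mem_of_mem_nhds hV') ξ hξ₁ hξ₂

end Trajectory

/-! ### Runs with identity inputs as noisy trajectories -/

section Runs

variable {Ω : Type*} [mΩ : MeasurableSpace Ω] {prob : Measure Ω}
  {N d r : ℕ} {P : Config N d r d} {η σ : ℝ} {mode : ℕ → Fin N → Block} {ℱ : Filtration ℕ mΩ}
  {A : ℕ → Ω → Fin N → Matrix (Fin r) (Fin d) ℝ} {B : ℕ → Ω → Fin N → Matrix (Fin d) (Fin r) ℝ}
  {gA : ℕ → Ω → Fin N → Matrix (Fin r) (Fin d) ℝ} {gB : ℕ → Ω → Fin N → Matrix (Fin d) (Fin r) ℝ}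

/-- The inactive block carries zero noise, so one scalar `e` dominates both components and Markov's
inequality applies to it. -/
theorem IsRun.exists_noise (h : IsRun prob P η σ mode ℱ A B gA gB) (hX : ∀ n, P.X n = 1)
    (t : ℕ) (n : Fin N) :
    ∃ e : Ω → ℝ, Integrable e prob ∧ (∀ ω, 0 ≤ e ω) ∧ ∫ ω, e ω ∂prob ≤ σ ^ 2 ∧
      ∀ ω, ∃ ξ, frobSq ξ.1 ≤ e ω ∧ frobSq ξ.2 ≤ e ω ∧
        (A (t + 1) ω n, B (t + 1) ω n) =
          noisyStep η (P.Bstar n * P.Astar n) (mode t n) (A t ω n, B t ω n) ξ := by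
  cases hm : mode t n with
  | A =>
    have hg := h.grad_A t n hm
    refine ⟨_, hg.integrable_sq, fun ω => frobSq_nonneg _, hg.variance_le, fun ω =>
      ⟨(_, 0), le_rfl, by rw [frobSq_zero]; exact frobSq_nonneg _, ?_⟩⟩
    obtain ⟨h1, h2⟩ := h.step_A t n hm ω
    simp only [h1, h2, noisyStep, P.matGrad_A, hX, Matrix.mul_one, Matrix.transpose_one]
    congr 1
    simp only [smul_sub, smul_neg]
    abel
  | B =>
    have hg := h.grad_B t n hm
    refine ⟨_, hg.integrable_sq, fun ω => frobSq_nonneg _, hg.variance_le, fun ω =>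
      ⟨(0, _), by rw [frobSq_zero]; exact frobSq_nonneg _, le_rfl, ?_⟩⟩
    obtain ⟨h1, h2⟩ := h.step_B t n hm ω
    simp only [h1, h2, noisyStep, P.matGrad_B, hX, Matrix.mul_one]
    congr 1
    simp only [smul_sub, smul_neg]
    abel

theorem IsRun.ae_noisyStep_zero (h : IsRun prob P η 0 mode ℱ A B gA gB) (hX : ∀ n, P.X n = 1) :
    ∀ᵐ ω ∂prob, ∀ t n, (A (t + 1) ω n, B (t + 1) ω n) =
      noisyStep η (P.Bstar n * P.Astar n) (mode t n) (A t ω n, B t ω n) 0 := by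
  rw [ae_all_iff]
  intro t
  rw [ae_all_iff]
  intro n
  obtain ⟨e, hei, he0, hes, he⟩ := h.exists_noise hX t n
  have h1 : ∫ ω, e ω ∂prob = 0 :=
    le_antisymm (by simpa using hes) (integral_nonneg he0)
  have h2 := (integral_eq_zero_iff_of_nonneg he0 hei).mp h1
  filter_upwards [h2] with ω hω
  obtain ⟨ξ, hξ₁, hξ₂, hs⟩ := he ω
  rw [hω, Pi.zero_apply] at hξ₁ hξ₂
  have h3 : ξ = 0 := Prod.ext (frobSq_eq_zero (le_antisymm hξ₁ (frobSq_nonneg _)))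
    (frobSq_eq_zero (le_antisymm hξ₂ (frobSq_nonneg _)))
  rw [hs, h3]

theorem IsRun.measurable_risk (h : IsRun prob P η σ mode ℱ A B gA gB) (t : ℕ) :
    Measurable fun ω => P.risk (A t ω) (B t ω) := by
  have hA : ∀ n i j, Measurable fun ω => A t ω n i j := fun n i j =>
    (h.adapted_A t n i j).mono (ℱ.le t) le_rfl
  have hB : ∀ n i j, Measurable fun ω => B t ω n i j := fun n i j =>
    (h.adapted_B t n i j).mono (ℱ.le t) le_rfl
  simp only [Config.risk, frobSq, Matrix.sub_apply, Matrix.mul_apply]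
  fun_prop

/-- If, for a set of layers, small noise keeps the loss above `w`, so does the expected risk. -/
theorem IsRun.le_expectedRisk [IsProbabilityMeasure prob] (h : IsRun prob P η σ mode ℱ A B gA gB)
    (hX : ∀ n, P.X n = 1) {T : ℕ} {δ w : ℝ} (hδ : 0 < δ) (hw : 0 ≤ w)
    (hσ : 2 * (T * N * σ ^ 2) ≤ δ) (S : Finset (Fin N))
    (hS : ∀ n ∈ S, ∀ ω, IsNoisyTrajectory η (P.Bstar n * P.Astar n) δ T (fun t => mode t n)
      (fun t => (A t ω n, B t ω n)) → w ≤ frobSq (P.Bstar n * P.Astar n - B T ω n * A T ω n)) :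
    ENNReal.ofReal (1 / 2 * (1 / N * (S.card * w))) ≤ expectedRisk prob P A B T := by
  choose e hei he0 hes he using fun t n => h.exists_noise hX t n
  -- The event that some noise reaches `δ` before round `T`. Markov and a union bound give it
  -- probability at most `TNσ²/δ ≤ 1/2`.
  set bad : Set Ω := ⋃ t ∈ Finset.range T, ⋃ n ∈ (Finset.univ : Finset (Fin N)),
    {ω | δ ≤ e t n ω} with hbad
  have hbad1 : prob.real bad ≤ 1 / 2 := by
    have h1 : ∀ t n, prob.real {ω | δ ≤ e t n ω} ≤ σ ^ 2 / δ := by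
      intro t n
      rw [le_div_iff₀ hδ, mul_comm]
      exact (mul_meas_ge_le_integral_of_nonneg (ae_of_all _ (he0 t n)) (hei t n) δ).trans (hes t n)
    calc prob.real bad ≤ ∑ t ∈ Finset.range T, ∑ n, prob.real {ω | δ ≤ e t n ω} :=
          (measureReal_biUnion_finset_le _ _).trans
            (Finset.sum_le_sum fun t _ => measureReal_biUnion_finset_le _ _)
      _ ≤ ∑ t ∈ Finset.range T, ∑ n : Fin N, σ ^ 2 / δ :=
          Finset.sum_le_sum fun t _ => Finset.sum_le_sum fun n _ => h1 t n
      _ = T * N * σ ^ 2 / δ := by simp; ring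
      _ ≤ 1 / 2 := by rw [div_le_iff₀ hδ]; linarith
  set ε : ℝ := 1 / N * (S.card * w) with hε
  have hε0 : 0 ≤ ε := by positivity
  have hgood : Set.univ ⊆ {ω | ENNReal.ofReal ε ≤ ENNReal.ofReal (P.risk (A T ω) (B T ω))} ∪ bad := by
    intro ω _
    by_cases hω : ω ∈ bad
    · exact Or.inr hω
    · left
      have h1 : ∀ t < T, ∀ n, e t n ω < δ := by
        intro t ht n
        by_contra hc
        exact hω (Set.mem_biUnion (Finset.mem_coe.mpr (Finset.mem_range.mpr ht))
          (Set.mem_biUnion (Finset.mem_coe.mpr (Finset.mem_univ n)) (not_lt.mp hc)))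
      refine ENNReal.ofReal_le_ofReal (mul_le_mul_of_nonneg_left ?_ (by positivity))
      have h2 : ∀ n ∈ S, w ≤ frobSq (P.Bstar n * P.Astar n * P.X n - B T ω n * A T ω n * P.X n) := by
        intro n hn
        rw [hX, Matrix.mul_one, Matrix.mul_one]
        refine hS n hn ω fun t ht => ?_
        obtain ⟨ξ, hξ₁, hξ₂, hs⟩ := he t n ω
        exact ⟨ξ, hξ₁.trans_lt (h1 t ht n), hξ₂.trans_lt (h1 t ht n), hs⟩
      calc S.card * w = ∑ n ∈ S, w := by simp
        _ ≤ ∑ n ∈ S, frobSq (P.Bstar n * P.Astar n * P.X n - B T ω n * A T ω n * P.X n) :=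
            Finset.sum_le_sum h2
        _ ≤ _ := Finset.sum_le_sum_of_subset_of_nonneg (Finset.subset_univ S)
            fun n _ _ => frobSq_nonneg _
  have hm : AEMeasurable (fun ω => ENNReal.ofReal (P.risk (A T ω) (B T ω))) prob :=
    (h.measurable_risk T).ennreal_ofReal.aemeasurable
  have hhalf : ENNReal.ofReal (1 / 2) ≤
      prob {ω | ENNReal.ofReal ε ≤ ENNReal.ofReal (P.risk (A T ω) (B T ω))} := by
    have h1 : (1 : ℝ) ≤
        prob.real {ω | ENNReal.ofReal ε ≤ ENNReal.ofReal (P.risk (A T ω) (B T ω))} +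
          prob.real bad := by
      have h2 := (measureReal_mono hgood (μ := prob)).trans (measureReal_union_le _ _)
      rwa [probReal_univ] at h2
    refine ENNReal.ofReal_le_of_le_toReal ?_
    change 1 / 2 ≤ prob.real _
    linarith
  calc ENNReal.ofReal (1 / 2 * ε) = ENNReal.ofReal ε * ENNReal.ofReal (1 / 2) := by
        rw [mul_comm, ENNReal.ofReal_mul hε0]
    _ ≤ ENNReal.ofReal ε *
        prob {ω | ENNReal.ofReal ε ≤ ENNReal.ofReal (P.risk (A T ω) (B T ω))} := by gcongr
    _ ≤ expectedRisk prob P A B T := mul_meas_ge_le_lintegral₀ hm _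

end Runs

/-! ### An adversarial configuration for layer-tied schedules -/

section Adversarial

variable {d r N : ℕ}

/-- The rows of `E` and `F` together are orthonormal. -/
structure IsFrame (E F : Matrix (Fin r) (Fin d) ℝ) : Prop where
  left : E * Eᵀ = 1
  right : F * Fᵀ = 1
  left_right : E * Fᵀ = 0
  right_left : F * Eᵀ = 0

theorem exists_isFrame (h : 2 * r ≤ d) : ∃ E F : Matrix (Fin r) (Fin d) ℝ, IsFrame E F := by
  have key : ∀ f g : Fin r → Fin d,
      (Matrix.of fun i j => if f i = j then (1 : ℝ) else 0) *
        (Matrix.of fun i j => if g i = j then (1 : ℝ) else 0)ᵀ =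
          Matrix.of fun i j => if f i = g j then (1 : ℝ) else 0 := by
    intro f g
    ext i j
    simp [Matrix.mul_apply, eq_comm]
  set f : Fin r → Fin d := fun i => ⟨i, by omega⟩
  set g : Fin r → Fin d := fun i => ⟨i + r, by omega⟩
  refine ⟨Matrix.of fun i j => if f i = j then (1 : ℝ) else 0,
    Matrix.of fun i j => if g i = j then (1 : ℝ) else 0, ?_, ?_, ?_, ?_⟩
  all_goals
    rw [key]
    ext i j
    have hi := i.isLt
    have hj := j.isLt
    simp only [f, g, Matrix.of_apply, Matrix.one_apply, Matrix.zero_apply, Fin.ext_iff] <;> grind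

/-- As `B` is orthogonal to the target, the step only shrinks `A`, and `ηBᵀB = 1` makes it jump
exactly to `0`. Orthogonality also makes `BA` useless for the initial loss. -/
theorem isTrapped_A {η : ℝ} {W : Matrix (Fin d) (Fin d) ℝ} {A : Matrix (Fin r) (Fin d) ℝ}
    {B : Matrix (Fin d) (Fin r) ℝ} (h1 : Bᵀ * W = 0) (h2 : η • (Bᵀ * B) = 1) :
    IsTrapped η W Block.A (A, B) := by
  refine ⟨?_, (0, B), ?_, h1, by simp, by simp⟩
  · have h3 : (Wᵀ * (B * A)).trace = 0 := by
      rw [trace_transpose_mul_comm, Matrix.transpose_mul, Matrix.mul_assoc, h1]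
      simp
    rw [frobSq_sub, h3]
    linarith [frobSq_nonneg (B * A)]
  · have h3 : η • (Bᵀ * (B * A)) = A := by
      rw [← Matrix.mul_assoc, ← Matrix.smul_mul, h2, Matrix.one_mul]
    simp [noisyStep, Matrix.mul_sub, h1, h3]

theorem isTrapped_B {η : ℝ} {W : Matrix (Fin d) (Fin d) ℝ} {A : Matrix (Fin r) (Fin d) ℝ}
    {B : Matrix (Fin d) (Fin r) ℝ} (h1 : W * Aᵀ = 0) (h2 : η • (A * Aᵀ) = 1) :
    IsTrapped η W Block.B (A, B) := by
  refine ⟨?_, (A, 0), ?_, by simp, h1, by simp⟩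
  · have h3 : (Wᵀ * (B * A)).trace = 0 := by
      rw [trace_transpose_mul_comm, Matrix.trace_mul_comm, Matrix.transpose_mul, ← Matrix.mul_assoc,
        h1]
      simp
    rw [frobSq_sub, h3]
    linarith [frobSq_nonneg (B * A)]
  · have h3 : η • (B * A * Aᵀ) = B := by
      rw [Matrix.mul_assoc, ← Matrix.mul_smul, h2, Matrix.mul_one]
    simp [noisyStep, Matrix.sub_mul, h1, h3]

theorem isTrapped_of_eq_zero {η : ℝ} {W : Matrix (Fin d) (Fin d) ℝ} {A : Matrix (Fin r) (Fin d) ℝ}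
    (h1 : W * Aᵀ = 0) (k : Block) : IsTrapped η W k (A, 0) :=
  ⟨by simp, (A, 0), noisyStep_eq_self (by simp) h1 (by simp) k, by simp, h1, by simp⟩

/-- Identity inputs and the optimal pair `(aE, aEᵀ)`. A single layer starts at a saddle point.
Otherwise the layers of even index are trapped by a first update of `A` and those of odd index by a
first update of `B`. -/
noncomputable def trapConfig (N : ℕ) (a : ℝ) (E F : Matrix (Fin r) (Fin d) ℝ) :
    Config N d r d where
  Astar _ := a • E
  Bstar _ := a • Eᵀ
  X _ := 1
  A0 n := if N = 1 then a • F else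
    if n.val % 2 = 0 then a • ((3 / 5 : ℝ) • E + (4 / 5 : ℝ) • F) else a • F
  B0 n := if N = 1 then 0 else if n.val % 2 = 0 then a • Fᵀ else a • Eᵀ

/-- The layers of `trapConfig` trapped by a first update of the block `k`. -/
def trapSet (N : ℕ) (k : Block) : Finset (Fin N) :=
  match k with
  | Block.A => Finset.univ.filter fun n => N = 1 ∨ n.val % 2 = 0
  | Block.B => Finset.univ.filter fun n => N = 1 ∨ n.val % 2 = 1

theorem card_filter_mod_two (N : ℕ) :
    (Finset.univ.filter fun n : Fin N => n.val % 2 = 0).card = (N + 1) / 2 ∧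
      (Finset.univ.filter fun n : Fin N => n.val % 2 = 1).card = N / 2 := by
  simp only [Finset.card_filter, Fin.sum_univ_eq_sum_range (fun n => if n % 2 = 0 then 1 else 0),
    Fin.sum_univ_eq_sum_range (fun n => if n % 2 = 1 then 1 else 0)]
  induction N with
  | zero => simp
  | succ N ih =>
    rw [Finset.sum_range_succ, Finset.sum_range_succ, ih.1, ih.2]
    constructor <;> split_ifs <;> omega

/-- The factor `3` is forced by `N = 3`, which has a single odd index. -/
theorem le_three_mul_card_trapSet (hN : 1 ≤ N) (k : Block) : N ≤ 3 * (trapSet N k).card := by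
  rcases hN.eq_or_lt with rfl | h
  · cases k <;> simp [trapSet]
  · have h1 : N ≠ 1 := by omega
    obtain ⟨h2, h3⟩ := card_filter_mod_two N
    cases k <;> simp only [trapSet, h1, false_or, h2, h3] <;> omega

variable {a η : ℝ} {E F : Matrix (Fin r) (Fin d) ℝ}

theorem IsFrame.isTrapped (hEF : IsFrame E F) (ha : η * a ^ 2 = 1) {k : Block} {n : Fin N}
    (hn : n ∈ trapSet N k) : IsTrapped η (a • Eᵀ * (a • E)) k
      ((trapConfig N a E F).A0 n, (trapConfig N a E F).B0 n) := by
  have h1 : (a • Eᵀ * (a • E)) * (a • F)ᵀ = 0 := by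
    simp only [Matrix.transpose_smul, Matrix.smul_mul, Matrix.mul_smul, Matrix.mul_assoc,
      hEF.left_right, Matrix.mul_zero, smul_zero]
  have h2 : (a • Fᵀ)ᵀ * (a • Eᵀ * (a • E)) = 0 := by
    simp only [Matrix.transpose_smul, Matrix.transpose_transpose, ← Matrix.mul_assoc,
      Matrix.smul_mul, Matrix.mul_smul, hEF.right_left, Matrix.zero_mul, smul_zero]
  have h3 : η • ((a • F) * (a • F)ᵀ) = 1 := by
    rw [Matrix.transpose_smul, Matrix.smul_mul, Matrix.mul_smul, hEF.right, smul_smul a, ← sq,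
      smul_smul, ha, one_smul]
  by_cases hN : N = 1
  · simp only [trapConfig, hN, if_true]
    exact isTrapped_of_eq_zero h1 k
  · simp only [trapConfig, hN, if_false]
    cases k with
    | A =>
      simp only [trapSet, hN, false_or, Finset.mem_filter, Finset.mem_univ, true_and] at hn
      simp only [hn, if_true]
      refine isTrapped_A h2 ?_
      rw [← h3, Matrix.transpose_smul, Matrix.transpose_transpose, Matrix.transpose_smul]
    | B =>
      simp only [trapSet, hN, false_or, Finset.mem_filter, Finset.mem_univ, true_and] at hn
      simp only [hn, one_ne_zero, if_false]
      exact isTrapped_B h1 h3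

theorem IsFrame.frobSq_pos (hEF : IsFrame E F) (hr : 1 ≤ r) (ha : 0 < a) :
    0 < frobSq (a • Eᵀ * (a • E)) := by
  refine lt_of_le_of_ne (frobSq_nonneg _) fun h => ?_
  have h1 := frobSq_eq_zero h.symm
  have h2 : E * (a • Eᵀ * (a • E)) * Eᵀ = a ^ 2 • (1 : Matrix (Fin r) (Fin r) ℝ) := by
    simp only [Matrix.smul_mul, Matrix.mul_smul, smul_smul, ← sq]
    rw [← Matrix.mul_assoc, hEF.left, Matrix.one_mul, hEF.left]
  rw [h1] at h2
  have h3 := congrFun (congrFun h2 ⟨0, hr⟩) ⟨0, hr⟩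
  simp at h3
  exact (pow_pos ha 2).ne h3

/-- The weights `3/5` and `4/5` satisfy `(3/5)² + (4/5)² = 1`, so the mixed initialization keeps
orthogonal rows of length `a`. -/
theorem IsFrame.A0_mul_transpose (hEF : IsFrame E F) (n : Fin N) :
    (trapConfig N a E F).A0 n * ((trapConfig N a E F).A0 n)ᵀ = a ^ 2 • 1 := by
  have h1 : (a • F) * (a • F)ᵀ = a ^ 2 • 1 := by
    rw [Matrix.transpose_smul, Matrix.smul_mul, Matrix.mul_smul, hEF.right, smul_smul, ← sq]
  simp only [trapConfig]
  split_ifs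
  · exact h1
  · simp only [Matrix.transpose_smul, Matrix.transpose_add, Matrix.smul_mul, Matrix.mul_smul,
      Matrix.add_mul, Matrix.mul_add, hEF.left, hEF.right, hEF.left_right, hEF.right_left, smul_zero,
      smul_smul, add_zero, zero_add, ← add_smul]
    congr 1
    ring
  · exact h1

theorem frobSq_mul_of_scaled {p q s : ℕ} (V : Matrix (Fin p) (Fin q) ℝ) {K : Matrix (Fin q) (Fin s) ℝ}
    (hK : K * Kᵀ = a ^ 2 • 1) : frobSq (V * K) = a ^ 2 * frobSq V := by
  rw [← frobSq_transpose, ← frobSq_transpose V, frobSq_eq_trace, frobSq_eq_trace]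
  simp only [Matrix.transpose_mul, Matrix.transpose_transpose]
  rw [Matrix.mul_assoc, ← Matrix.mul_assoc K, hK]
  simp

theorem pinv_eq_of_mul_transpose {p q : ℕ} {K : Matrix (Fin p) (Fin q) ℝ} (ha : η * a ^ 2 = 1)
    (hK : K * Kᵀ = a ^ 2 • 1) : pinv K = η • Kᵀ := by
  have h1 : K * (η • Kᵀ) = 1 := by rw [Matrix.mul_smul, hK, smul_smul, ha, one_smul]
  refine (pinv_spec K).unique ⟨?_, ?_, ?_, ?_⟩
  · rw [h1, Matrix.one_mul]
  · rw [Matrix.mul_assoc, h1, Matrix.mul_one]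
  · rw [h1, Matrix.transpose_one]
  · simp [Matrix.transpose_mul]

theorem sigmaMax_one (hd : 0 < d) : sigmaMax (1 : Matrix (Fin d) (Fin d) ℝ) = 1 :=
  singularValues_eq_of_transpose_mul_self zero_le_one (by simp) hd

/-- All factors are `a` times an isometry or its transpose, so each Hessian is `a²` times the
identity. The pseudoinverse of `A⁰` has all singular values `ηa = 1/a`, hence `κ = a`. -/
theorem IsFrame.regime (hEF : IsFrame E F) (hr : 1 ≤ r) (hd : 2 * r ≤ d) (ha0 : 0 < a)
    (hη : 0 < η) (ha : η * a ^ 2 = 1) :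
    (trapConfig N a E F).Regime a (a ^ 2) (a ^ 2) 1 1 := by
  have hE : (a • E) * (a • E)ᵀ = a ^ 2 • 1 := by
    rw [Matrix.transpose_smul, Matrix.smul_mul, Matrix.mul_smul, hEF.left, smul_smul, ← sq]
  have hs : sigmaMax (1 : Matrix (Fin d) (Fin d) ℝ) = 1 := sigmaMax_one (by omega)
  refine ⟨fun n V => ?_, fun n V => ?_, fun n B' V => ?_, fun n => ?_, fun n => ?_⟩
  · have h1 : frobSq (a • Eᵀ * V * (1 : Matrix (Fin d) (Fin d) ℝ)) = a ^ 2 * frobSq V := by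
      rw [Matrix.mul_one, ← frobSq_transpose, Matrix.transpose_mul, Matrix.transpose_smul,
        Matrix.transpose_transpose, frobSq_mul_of_scaled _ hE, frobSq_transpose]
    rw [Config.hessForm_A]
    exact ⟨h1.ge, h1.le⟩
  · have h1 : frobSq (V * (a • E * (1 : Matrix (Fin d) (Fin d) ℝ))) = a ^ 2 * frobSq V := by
      rw [Matrix.mul_one, frobSq_mul_of_scaled _ hE]
    rw [Config.hessForm_B]
    exact ⟨h1.ge, h1.le⟩
  · have h1 : frobSq (V * ((trapConfig N a E F).A0 n * (1 : Matrix (Fin d) (Fin d) ℝ))) = a ^ 2 * frobSq V := by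
      rw [Matrix.mul_one, frobSq_mul_of_scaled _ (hEF.A0_mul_transpose n)]
    rw [Config.hessForm_B]
    exact ⟨h1.ge, h1.le⟩
  · have h1 := pinv_eq_of_mul_transpose ha (hEF.A0_mul_transpose (a := a) n)
    have h2 : sigmaMinPos ((1 : Matrix (Fin d) (Fin d) ℝ)ᵀ * pinv ((trapConfig N a E F).A0 n)) =
        η * a := by
      rw [Matrix.transpose_one, Matrix.one_mul, sigmaMinPos]
      refine singularValues_eq_of_transpose_mul_self (by positivity) ?_ ?_
      · rw [h1, Matrix.transpose_smul, Matrix.transpose_transpose, Matrix.smul_mul, Matrix.mul_smul,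
          hEF.A0_mul_transpose, smul_smul, smul_smul]
        congr 1
        ring
      -- The index `rank - 1` is below `r` because `r ≥ 1`.
      · have := Matrix.rank_le_width (pinv ((trapConfig N a E F).A0 n))
        omega
    change sigmaMax (1 : Matrix (Fin d) (Fin d) ℝ) ≤ a * _
    refine le_of_eq ?_
    rw [hs]
    refine Eq.trans ?_ (congrArg (a * ·) h2).symm
    linarith
  · exact ⟨hs.ge, hs.le⟩

theorem IsFrame.misalign_pos (hEF : IsFrame E F) (hr : 1 ≤ r) (ha : 0 < a) (n : Fin N) :
    0 < (trapConfig N a E F).misalign n := by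
  have hW := hEF.frobSq_pos hr ha
  -- Misalignment is detected by directions that `A⁰` kills but `A⋆` does not.
  have key : ∀ Z : Matrix (Fin d) (Fin r) ℝ, (trapConfig N a E F).A0 n * Z = 0 →
      E * Z ≠ 0 → 0 < (trapConfig N a E F).misalign n := by
    intro Z hZ hEZ
    refine lt_of_le_of_ne (Real.sqrt_nonneg _) fun h => ?_
    have h1 := (trapConfig N a E F).misalign_sq n
    rw [← h] at h1
    have h2 := frobSq_eq_zero (by rw [← h1]; simp)
    have h3 := congrArg (fun M => E * (M * Z)) h2
    simp only [Matrix.sub_mul, rowProj, hZ, Matrix.one_mul,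
      Matrix.mul_assoc _ _ Z, Matrix.mul_zero, sub_zero, Matrix.zero_mul] at h3
    simp only [trapConfig, Matrix.smul_mul, Matrix.mul_smul] at h3
    rw [← Matrix.mul_assoc, hEF.left, Matrix.one_mul, smul_smul] at h3
    exact hEZ ((smul_eq_zero.mp h3).resolve_left (mul_pos ha ha).ne')
  have hne : (1 : Matrix (Fin r) (Fin r) ℝ) ≠ 0 := by
    intro h
    have := congrFun (congrFun h ⟨0, hr⟩) ⟨0, hr⟩
    simp at this
  by_cases hn : N ≠ 1 ∧ n.val % 2 = 0
  -- The rotation by a right angle of the mixed rows inside the span of `E` and `F`.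
  · refine key ((4 / 5 : ℝ) • Eᵀ - (3 / 5 : ℝ) • Fᵀ) ?_ ?_
    · simp only [trapConfig, hn, if_true, if_false, Matrix.smul_mul, Matrix.mul_smul,
        Matrix.add_mul, Matrix.mul_sub, hEF.left, hEF.right, hEF.left_right, hEF.right_left,
        smul_zero, smul_smul, smul_add]
      rw [add_zero, zero_add, sub_eq_zero]
      congr 1
      ring
    · simp [Matrix.mul_sub, hEF.left, hEF.left_right, hne]
  · refine key Eᵀ ?_ (by rwa [hEF.left])
    have h1 : (trapConfig N a E F).A0 n = a • F := by
      simp only [trapConfig]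
      split_ifs with h2 h3
      · rfl
      · exact absurd ⟨h2, h3⟩ hn
      · rfl
    rw [h1, Matrix.smul_mul, hEF.right_left, smul_zero]

theorem meanSqMisalign_trapConfig_le (N : ℕ) (a : ℝ) (E F : Matrix (Fin r) (Fin d) ℝ) :
    (trapConfig N a E F).meanSqMisalign ≤ frobSq (a • Eᵀ * (a • E)) := by
  have h1 : ∀ n, (trapConfig N a E F).misalign n ^ 2 ≤ frobSq (a • Eᵀ * (a • E)) := by
    intro n
    rw [Config.misalign_sq]
    exact frobSq_mul_one_sub_le _ (rowProj_transpose _) (rowProj_mul_self _)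
  calc (trapConfig N a E F).meanSqMisalign
      ≤ 1 / (N : ℝ) * ∑ n : Fin N, frobSq (a • Eᵀ * (a • E)) :=
        mul_le_mul_of_nonneg_left (Finset.sum_le_sum fun n _ => h1 n) (by positivity)
    _ = ((N : ℝ)⁻¹ * N) * frobSq (a • Eᵀ * (a • E)) := by simp; ring
    _ ≤ _ := mul_le_of_le_one_left (frobSq_nonneg _) inv_mul_le_one

/-- The constant is `1/12 = 1/2 · 1/3 · 1/2`: probability of small noise, fraction of trapped
layers, fraction of `‖W‖²` kept by each of them. -/
theorem IsFrame.tied_floor (hEF : IsFrame E F) (hr : 1 ≤ r) (hN : 1 ≤ N) (ha0 : 0 < a)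
    (ha : η * a ^ 2 = 1) (T : ℕ) :
    ∃ σ₀ : ℝ, 0 < σ₀ ∧ ∀ σ : ℝ, 0 ≤ σ → σ ≤ σ₀ → ∀ M : ℕ → Block,
      ∀ (Ω : Type*) [mΩ : MeasurableSpace Ω] (prob : Measure Ω) [IsProbabilityMeasure prob]
        (ℱ : Filtration ℕ mΩ)
        (A : ℕ → Ω → Fin N → Matrix (Fin r) (Fin d) ℝ)
        (B : ℕ → Ω → Fin N → Matrix (Fin d) (Fin r) ℝ)
        (gA : ℕ → Ω → Fin N → Matrix (Fin r) (Fin d) ℝ)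
        (gB : ℕ → Ω → Fin N → Matrix (Fin d) (Fin r) ℝ),
      IsRun prob (trapConfig N a E F) η σ (tiedMode N M) ℱ A B gA gB →
        ENNReal.ofReal (1 / 12 * (trapConfig N a E F).meanSqMisalign) ≤
          expectedRisk prob (trapConfig N a E F) A B T := by
  set W := a • Eᵀ * (a • E) with hWdef
  have hW : 0 < frobSq W := hEF.frobSq_pos hr ha0
  have h1 : ∀ k, ∀ᶠ δ in 𝓝[>] (0 : ℝ), ∀ n ∈ trapSet N k, ∀ (M : ℕ → Block)
      (x : ℕ → Matrix (Fin r) (Fin d) ℝ × Matrix (Fin d) (Fin r) ℝ), M 0 = k →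
      x 0 = ((trapConfig N a E F).A0 n, (trapConfig N a E F).B0 n) →
      IsNoisyTrajectory η W δ T M x → frobSq W / 2 ≤ frobSq (W - (x T).2 * (x T).1) := by
    intro k
    rw [Filter.eventually_all_finset]
    exact fun n hn => (hEF.isTrapped ha hn).eventually_le hW T
  obtain ⟨δ, ⟨hA, hB⟩, hδ⟩ := (((h1 Block.A).and (h1 Block.B)).and self_mem_nhdsWithin).exists
  have hδ0 : 0 < δ := hδ
  have hδT : ∀ k, ∀ n ∈ trapSet N k, ∀ (M : ℕ → Block)
      (x : ℕ → Matrix (Fin r) (Fin d) ℝ × Matrix (Fin d) (Fin r) ℝ), M 0 = k →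
      x 0 = ((trapConfig N a E F).A0 n, (trapConfig N a E F).B0 n) →
      IsNoisyTrajectory η W δ T M x → frobSq W / 2 ≤ frobSq (W - (x T).2 * (x T).1)
    | Block.A => hA
    | Block.B => hB
  -- Chosen so that `2TNσ² ≤ δ`; the `+ 1` keeps the denominator positive at `T = 0`.
  refine ⟨Real.sqrt (δ / (2 * (T * N) + 1)), Real.sqrt_pos.mpr (by positivity), ?_⟩
  intro σ hσ0 hσ M Ω mΩ prob _ ℱ A B gA gB h
  have hσ2 : 2 * (T * N * σ ^ 2) ≤ δ := by
    have h2 : σ ^ 2 ≤ δ / (2 * (T * N) + 1) := by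
      rw [← Real.sq_sqrt (show 0 ≤ δ / (2 * ((T : ℝ) * N) + 1) by positivity)]
      exact pow_le_pow_left₀ hσ0 hσ 2
    rw [le_div_iff₀ (by positivity)] at h2
    linarith [sq_nonneg σ]
  have hk : ∀ n ∈ trapSet N (M 0), ∀ ω, IsNoisyTrajectory η W δ T (fun t => tiedMode N M t n)
      (fun t => (A t ω n, B t ω n)) → frobSq W / 2 ≤ frobSq (W - B T ω n * A T ω n) := by
    intro n hn ω hx
    have hx0 : (A 0 ω n, B 0 ω n) = ((trapConfig N a E F).A0 n, (trapConfig N a E F).B0 n) := by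
      rw [(h.init ω n).1, (h.init ω n).2]
    exact hδT (M 0) n hn M (fun t => (A t ω n, B t ω n)) rfl hx0 hx
  refine le_trans (ENNReal.ofReal_le_ofReal ?_)
    (h.le_expectedRisk (fun _ => rfl) hδ0 (by positivity) hσ2 (trapSet N (M 0)) hk)
  have h3 := meanSqMisalign_trapConfig_le N a E F
  have h4 : (N : ℝ) ≤ 3 * (trapSet N (M 0)).card := by
    exact_mod_cast le_three_mul_card_trapSet hN (M 0)
  have hN0 : (0 : ℝ) < N := by exact_mod_cast hN
  calc 1 / 12 * (trapConfig N a E F).meanSqMisalign ≤ 1 / 12 * frobSq W := by linarith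
    _ = 1 / 2 * (1 / N * (N / 3 * (frobSq W / 2))) := by field_simp; norm_num
    _ ≤ 1 / 2 * (1 / N * ((trapSet N (M 0)).card * (frobSq W / 2))) := by
        gcongr
        linarith

/-- Once `B` is a multiple of `Eᵀ`, exact descent in `A` contracts the residual. -/
theorem IsFrame.frobSq_residual_contract (hEF : IsFrame E F) {b : ℝ}
    {x : ℕ → Matrix (Fin r) (Fin d) ℝ × Matrix (Fin d) (Fin r) ℝ} (h0 : (x 0).2 = b • Eᵀ)
    (hx : ∀ t, x (t + 1) = noisyStep η (a • Eᵀ * (a • E)) Block.A (x t) 0) (t : ℕ) :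
    (x t).2 = b • Eᵀ ∧ a • Eᵀ * (a • E) - (x t).2 * (x t).1 =
      (1 - η * b ^ 2) ^ t • (a • Eᵀ * (a • E) - (x 0).2 * (x 0).1) := by
  induction t with
  | zero => simp [h0]
  | succ t ih =>
    obtain ⟨h1, h2⟩ := ih
    have h3 : (x (t + 1)).2 = b • Eᵀ := by rw [hx]; exact h1
    refine ⟨h3, ?_⟩
    set R := a • Eᵀ * (a • E) - (x t).2 * (x t).1 with hR
    -- Both `W` and `B` have left factor `Eᵀ`, so the projector `EᵀE` fixes the residual.
    have h4 : Eᵀ * (E * R) = R := by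
      rw [hR, h1, Matrix.smul_mul, Matrix.smul_mul, Matrix.mul_sub, Matrix.mul_sub]
      simp only [Matrix.mul_smul, ← Matrix.mul_assoc]
      simp only [Matrix.mul_assoc Eᵀ E Eᵀ, hEF.left, Matrix.mul_one]
    have h5 : (x (t + 1)).1 = (x t).1 + η • ((b • Eᵀ)ᵀ * R) := by
      rw [hx]
      simp [noisyStep, h1, hR]
    have h6 : a • Eᵀ * (a • E) - (x (t + 1)).2 * (x (t + 1)).1 = (1 - η * b ^ 2) • R := by
      rw [h3, h5, Matrix.mul_add, ← sub_sub, ← h1, ← hR, h1]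
      simp only [Matrix.transpose_smul, Matrix.transpose_transpose, Matrix.smul_mul,
        Matrix.mul_smul, h4, smul_smul]
      rw [sub_smul, one_smul]
      congr 2
      ring
    rw [h6, h2, smul_smul, ← pow_succ']

/-- The layer-wise schedule that avoids the traps: in the first round the layers of even index
update `B` and the others `A`; afterwards all layers update `A`. -/
def escapeMode (N : ℕ) (t : ℕ) (n : Fin N) : Block :=
  if t = 0 ∧ n.val % 2 = 0 then Block.B else Block.A

theorem IsFrame.tendsto_expectedRisk (hEF : IsFrame E F) (hN : 2 ≤ N) (ha : η * a ^ 2 = 1)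
    {Ω : Type*} [mΩ : MeasurableSpace Ω] {prob : Measure Ω} [IsProbabilityMeasure prob]
    {ℱ : Filtration ℕ mΩ}
    {A : ℕ → Ω → Fin N → Matrix (Fin r) (Fin d) ℝ}
    {B : ℕ → Ω → Fin N → Matrix (Fin d) (Fin r) ℝ}
    {gA : ℕ → Ω → Fin N → Matrix (Fin r) (Fin d) ℝ}
    {gB : ℕ → Ω → Fin N → Matrix (Fin d) (Fin r) ℝ}
    (h : IsRun prob (trapConfig N a E F) η 0 (escapeMode N) ℱ A B gA gB) :
    Tendsto (expectedRisk prob (trapConfig N a E F) A B) atTop (𝓝 0) := by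
  have hN1 : N ≠ 1 := by omega
  set W := a • Eᵀ * (a • E) with hW
  set x₁ : Fin N → Matrix (Fin r) (Fin d) ℝ × Matrix (Fin d) (Fin r) ℝ := fun n =>
    noisyStep η W (escapeMode N 0 n)
      ((trapConfig N a E F).A0 n, (trapConfig N a E F).B0 n) 0 with hx₁
  have hb : ∀ n, ∃ b, (x₁ n).2 = b • Eᵀ ∧ 0 ≤ 1 - η * b ^ 2 ∧ 1 - η * b ^ 2 < 1 := by
    intro n
    by_cases hn : n.val % 2 = 0
    -- Since `ηA⁰A⁰ᵀ = 1`, the first `B`-step erases `B⁰` and leaves `ηWA⁰ᵀ`, which sees only the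
    -- `E`-part of `A⁰`. The contraction factor is `1 - 9/25`.
    · refine ⟨3 / 5 * a, ?_, by nlinarith, by nlinarith⟩
      have h1 : (x₁ n).2 = (trapConfig N a E F).B0 n +
          η • ((W - (trapConfig N a E F).B0 n * (trapConfig N a E F).A0 n) *
            ((trapConfig N a E F).A0 n)ᵀ) := by
        simp [hx₁, escapeMode, hn, noisyStep]
      have h2 : W * ((trapConfig N a E F).A0 n)ᵀ = (3 / 5 * a ^ 3) • Eᵀ := by
        simp only [trapConfig, hN1, hn, if_true, if_false, hW, Matrix.transpose_smul,
          Matrix.transpose_add, Matrix.smul_mul, Matrix.mul_smul, Matrix.mul_add, Matrix.mul_assoc,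
          hEF.left, hEF.left_right, Matrix.mul_one, Matrix.mul_zero, smul_zero, add_zero, smul_smul]
        congr 1
        ring
      rw [h1, Matrix.sub_mul, h2, Matrix.mul_assoc, hEF.A0_mul_transpose, smul_sub, Matrix.mul_smul,
        smul_smul, smul_smul, ha, Matrix.mul_one, one_smul, add_sub_cancel]
      congr 1
      linear_combination (3 / 5 * a) * ha
    -- On odd layers an `A`-step leaves `B = aEᵀ`, and the contraction factor is `0`.
    · refine ⟨a, ?_, by rw [ha]; norm_num, by rw [ha]; norm_num⟩
      simp [hx₁, escapeMode, hn, noisyStep, trapConfig, hN1]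
  choose b hb hb0 hb1 using hb
  have hrisk : ∀ t, expectedRisk prob (trapConfig N a E F) A B (t + 1) =
      ENNReal.ofReal (1 / (N : ℝ) * ∑ n, ((1 - η * b n ^ 2) ^ t) ^ 2 *
        frobSq (W - (x₁ n).2 * (x₁ n).1)) := by
    intro t
    have h1 : ∀ᵐ ω ∂prob, ENNReal.ofReal ((trapConfig N a E F).risk (A (t + 1) ω) (B (t + 1) ω)) =
        ENNReal.ofReal (1 / (N : ℝ) * ∑ n, ((1 - η * b n ^ 2) ^ t) ^ 2 *
          frobSq (W - (x₁ n).2 * (x₁ n).1)) := by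
      filter_upwards [h.ae_noisyStep_zero fun _ => rfl] with ω hω
      rw [Config.risk]
      congr 2
      refine Finset.sum_congr rfl fun n _ => ?_
      have h2 : (A 1 ω n, B 1 ω n) = x₁ n := by
        have h3 := hω 0 n
        rw [(h.init ω n).1, (h.init ω n).2] at h3
        exact h3
      have h4 := (hEF.frobSq_residual_contract (a := a) (η := η) (b := b n)
        (x := fun t => (A (t + 1) ω n, B (t + 1) ω n))
        (by simpa only [← h2] using hb n)
        (fun t => by
          have h5 := hω (t + 1) n
          rw [escapeMode, if_neg (by omega)] at h5
          exact h5) t).2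
      simp only [zero_add] at h4
      change frobSq (W * 1 - B (t + 1) ω n * A (t + 1) ω n * 1) = _
      rw [Matrix.mul_one, Matrix.mul_one, hW, h4, frobSq_smul, ← h2]
    rw [expectedRisk, lintegral_congr_ae h1]
    simp
  rw [← tendsto_add_atTop_iff_nat 1]
  simp only [hrisk]
  rw [← ENNReal.ofReal_zero]
  refine ENNReal.tendsto_ofReal ?_
  have h1 : Tendsto (fun t : ℕ => 1 / (N : ℝ) * ∑ n, ((1 - η * b n ^ 2) ^ t) ^ 2 *
      frobSq (W - (x₁ n).2 * (x₁ n).1)) atTop (𝓝 (1 / (N : ℝ) * ∑ n : Fin N, 0 ^ 2 *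
      frobSq (W - (x₁ n).2 * (x₁ n).1))) :=
    (tendsto_finsetSum _ fun n _ => ((tendsto_pow_atTop_nhds_zero_of_lt_one (hb0 n)
      (hb1 n)).pow 2).mul_const _).const_mul _
  simpa using h1

end Adversarial

end LoRAFloor

theorem theorem2 :
    -- the floor of FFA-LoRA
    (∀ κ μ β sLo sHi : ℝ, 0 < κ → 0 < μ → 0 < β → 0 < sLo → 0 < sHi →
      ∃ c C : ℝ, 0 < c ∧ 0 < C ∧
        ∀ (N d r m : ℕ) (P : LoRAFloor.Config N d r m), P.Regime κ μ β sLo sHi →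
        ∀ η σ : ℝ, 0 < η → η * β ≤ 1 → 0 ≤ σ →
        ∀ (Ω : Type*) [mΩ : MeasurableSpace Ω] (prob : Measure Ω) [IsProbabilityMeasure prob]
          (ℱ : Filtration ℕ mΩ)
          (A : ℕ → Ω → Fin N → Matrix (Fin r) (Fin d) ℝ)
          (B : ℕ → Ω → Fin N → Matrix (Fin d) (Fin r) ℝ)
          (gA : ℕ → Ω → Fin N → Matrix (Fin r) (Fin d) ℝ)
          (gB : ℕ → Ω → Fin N → Matrix (Fin d) (Fin r) ℝ),
        LoRAFloor.IsRun prob P η σ (LoRAFloor.ffaMode N) ℱ A B gA gB →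
          ENNReal.ofReal (c * P.meanSqMisalign) ≤
              liminf (LoRAFloor.expectedRisk prob P A B) atTop ∧
            limsup (LoRAFloor.expectedRisk prob P A B) atTop ≤
              ENNReal.ofReal (C * (P.meanSqMisalign + η * σ ^ 2)) ∧
            (LoRAFloor.NoiseCovConverges prob P A B gB →
              ∃ l : ℝ, Tendsto (LoRAFloor.expectedRisk prob P A B) atTop
                  (𝓝 (ENNReal.ofReal l)) ∧
                c * P.meanSqMisalign ≤ l ∧ l ≤ C * (P.meanSqMisalign + η * σ ^ 2))) ∧
    -- the floor of layer-tied schedules on adversarial layer configurations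
    (∃ c : ℝ, 0 < c ∧ ∀ η : ℝ, 0 < η →
      ∃ κ μ β sLo sHi : ℝ, 0 < κ ∧ 0 < μ ∧ 0 < β ∧ 0 < sLo ∧ 0 < sHi ∧ η * β ≤ 1 ∧
        ∀ N d r : ℕ, 1 ≤ N → 1 ≤ r → 2 * r ≤ d →
        ∃ (m : ℕ) (P : LoRAFloor.Config N d r m), P.Regime κ μ β sLo sHi ∧
          (∀ n, 0 < P.misalign n) ∧
          (∀ T : ℕ, ∃ σ₀ : ℝ, 0 < σ₀ ∧ ∀ σ : ℝ, 0 ≤ σ → σ ≤ σ₀ → ∀ M : ℕ → LoRAFloor.Block,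
            ∀ (Ω : Type*) [mΩ : MeasurableSpace Ω] (prob : Measure Ω) [IsProbabilityMeasure prob]
              (ℱ : Filtration ℕ mΩ)
              (A : ℕ → Ω → Fin N → Matrix (Fin r) (Fin d) ℝ)
              (B : ℕ → Ω → Fin N → Matrix (Fin d) (Fin r) ℝ)
              (gA : ℕ → Ω → Fin N → Matrix (Fin r) (Fin d) ℝ)
              (gB : ℕ → Ω → Fin N → Matrix (Fin d) (Fin r) ℝ),
            LoRAFloor.IsRun prob P η σ (LoRAFloor.tiedMode N M) ℱ A B gA gB →
              ENNReal.ofReal (c * P.meanSqMisalign) ≤ LoRAFloor.expectedRisk prob P A B T) ∧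
          (2 ≤ N → ∃ mode : ℕ → Fin N → LoRAFloor.Block,
            ∀ (Ω : Type*) [mΩ : MeasurableSpace Ω] (prob : Measure Ω) [IsProbabilityMeasure prob]
              (ℱ : Filtration ℕ mΩ)
              (A : ℕ → Ω → Fin N → Matrix (Fin r) (Fin d) ℝ)
              (B : ℕ → Ω → Fin N → Matrix (Fin d) (Fin r) ℝ)
              (gA : ℕ → Ω → Fin N → Matrix (Fin r) (Fin d) ℝ)
              (gB : ℕ → Ω → Fin N → Matrix (Fin d) (Fin r) ℝ),
            LoRAFloor.IsRun prob P η 0 mode ℱ A B gA gB →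
              Tendsto (LoRAFloor.expectedRisk prob P A B) atTop (𝓝 0))) := by
  refine ⟨fun κ μ β sLo sHi _ hμ hβ hs hsHi => LoRAFloor.ffa_floor κ μ β sLo sHi hμ hβ hs hsHi,
    1 / 12, by norm_num, fun η hη => ?_⟩
  -- The curvature `a²` is matched to the step size, the extreme case `ηβ = 1` of the admissible
  -- range.
  obtain ⟨a, ha0, ha⟩ : ∃ a : ℝ, 0 < a ∧ η * a ^ 2 = 1 := by
    refine ⟨Real.sqrt η⁻¹, Real.sqrt_pos.mpr (inv_pos.mpr hη), ?_⟩
    rw [Real.sq_sqrt (inv_pos.mpr hη).le, mul_inv_cancel₀ hη.ne']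
  refine ⟨a, a ^ 2, a ^ 2, 1, 1, ha0, pow_pos ha0 2, pow_pos ha0 2, one_pos, one_pos, ha.le, ?_⟩
  intro N d r hN hr hd
  obtain ⟨E, F, hEF⟩ := LoRAFloor.exists_isFrame hd
  exact ⟨d, LoRAFloor.trapConfig N a E F, hEF.regime hr hd ha0 hη ha, hEF.misalign_pos hr ha0,
    hEF.tied_floor hr hN ha0 ha, fun hN2 => ⟨LoRAFloor.escapeMode N,
      fun Ω _ prob _ ℱ A B gA gB h => hEF.tendsto_expectedRisk hN2 ha h⟩⟩
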